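/- For an entire function $f$ put $f^*(z)=\overline{f(\overline z)}$. Let $\mathcal{HB}$ be the set of entire functions $E$ with $|E(\overline z)|<|E(z)|$ whenever $\operatorname{Im} z>0$. For $E\in\mathcal{HB}$ the de Branges space $\mathcal H(E)$ consists of all entire functions $f$ with $\|f\|_E^2=\int_{\mathbb R}|f(t)/E(t)|^2\,dt<\infty$ such that $f/E$ and $f^*/E$ are of bounded type (quotients of two bounded analytic functions) and of nonpositive mean type ($\limsup_{y\to+\infty} y^{-1}\log|\cdot(iy)|\le 0$) in the upper half-plane. Let $$K_E(w,z)=\frac{\overline{E(w)}E(z)-E(\overline w)E^*(z)}{2\pi i(\overline w-z)},$$ extended by continuity to $z=\overline w$. A phase function of $E$ is a continuous, strictly increasing $\varphi:\mathbb R\to\mathbb R$ such that $E(x)e^{i\varphi(x)}\in\mathbb R$ for all $x\in\mathbb R$. Let $E,F\in\mathcal{HB}$, let $\varphi_{EF}$ be a phase function of $EF$, let $\alpha\in[0,\pi)$, and let $\{\lambda_n\}_{n\in I}\subset\mathbb R$, where $I\subseteq\mathbb Z$ (for instance $I=\mathbb Z$), satisfy $\varphi_{EF}(\lambda_n)=n\pi+\alpha$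 for all $n\in I$. Suppose that $\{K_{EF}(\lambda_n,\cdot)\}_{n\in I}$ is complete in $\mathcal H(EF)$, i.e. that its finite linear combinations approximate every element of $\mathcal H(EF)$ in norm. Then for all $f\in\mathcal H(E)$ and $g\in\mathcal H(F)$ and every $z\in\mathbb C$, $$f(z)=\sum_{n\in I}\bigl(f(\lambda_n)F(\lambda_n)+g(\lambda_n)E^*(\lambda_n)\bigr)\frac{\overline{F(\lambda_n)}\,K_E(\lambda_n,z)}{K_{EF}(\lambda_n,\lambda_n)},$$ $$g(z)=\sum_{n\in I}\bigl(f(\lambda_n)F(\lambda_n)+g(\lambda_n)E^*(\lambda_n)\bigr)\frac{E(\lambda_n)\,K_F(\lambda_n,z)}{K_{EF}(\lambda_n,\lambda_n)}.$$ Both series converge unconditionally, pointwise on $\mathbb C$ and in the norm of $\mathcal H(E)$, respectively $\mathcal H(F)$. -/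

import Mathlib

open Filter Topology MeasureTheory
open scoped ComplexConjugate ENNReal

noncomputable section

/-- The entire function `f*(z) = conj (f (conj z))`. -/
def entireStar (f : ℂ → ℂ) : ℂ → ℂ := fun z => conj (f (conj z))

/-- The Hermite-Biehler class: entire functions with `|E(conj z)| < |E(z)|` in the open upper
half-plane. Real zeros are allowed. -/
structure IsHermiteBiehler (E : ℂ → ℂ) : Prop where
  entire : Differentiable ℂ E
  norm_conj_lt : ∀ z : ℂ, 0 < z.im → ‖E (conj z)‖ < ‖E z‖

/-- `f` is analytic and of bounded type in the open upper half-plane: it is a quotient `P / Q` of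
two bounded analytic functions there, where `Q` is not identically zero. -/
def IsBoundedType (f : ℂ → ℂ) : Prop :=
  DifferentiableOn ℂ f {z : ℂ | 0 < z.im} ∧
  ∃ P Q : ℂ → ℂ,
    DifferentiableOn ℂ P {z : ℂ | 0 < z.im} ∧ DifferentiableOn ℂ Q {z : ℂ | 0 < z.im} ∧
    (∃ M : ℝ, ∀ z : ℂ, 0 < z.im → ‖P z‖ ≤ M ∧ ‖Q z‖ ≤ M) ∧
    (∃ z : ℂ, 0 < z.im ∧ Q z ≠ 0) ∧
    ∀ z : ℂ, 0 < z.im → f z * Q z = P z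

/-- The mean type `limsup_{y → +∞} log |f(iy)| / y`, an extended real number; here
`log 0 = -∞`, so that the zero function has mean type `-∞`. -/
def meanType (f : ℂ → ℂ) : EReal :=
  limsup (fun y : ℝ => ENNReal.log ‖f (y * Complex.I)‖ₑ / (y : EReal)) atTop

/-- The squared norm `‖f‖_E ^ 2 = ∫ |f(t) / E(t)| ^ 2 dt` (over the real line), in `[0, ∞]`. -/
def deBrangesNormSq (E f : ℂ → ℂ) : ℝ≥0∞ :=
  ∫⁻ t : ℝ, ‖f t / E t‖ₑ ^ 2

/-- The de Branges space `H(E)`: all entire functions `f` of finite norm such that `f / E` and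
`f* / E` are of bounded type and nonpositive mean type in the upper half-plane. -/
def deBrangesSpace (E : ℂ → ℂ) : Set (ℂ → ℂ) :=
  {f | Differentiable ℂ f ∧ deBrangesNormSq E f < ∞ ∧
    (IsBoundedType (fun z => f z / E z) ∧ meanType (fun z => f z / E z) ≤ 0) ∧
    (IsBoundedType (fun z => entireStar f z / E z) ∧
      meanType (fun z => entireStar f z / E z) ≤ 0)}

/-- The numerator `conj (E w) E(z) - E(conj w) E*(z)` of the reproducing kernel. -/
def kernelNumerator (E : ℂ → ℂ) (w z : ℂ) : ℂ :=
  conj (E w) * E z - E (conj w) * entireStar E z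

/-- The reproducing kernel
`K_E(w, z) = (conj (E w) E(z) - E(conj w) E*(z)) / (2 π i (conj w - z))`.
At `z = conj w`, where the numerator vanishes, it is extended by continuity. -/
def deBrangesKernel (E : ℂ → ℂ) (w z : ℂ) : ℂ :=
  if z = conj w then
    -deriv (kernelNumerator E w) (conj w) / (2 * Real.pi * Complex.I)
  else
    kernelNumerator E w z / (2 * Real.pi * Complex.I * (conj w - z))

/-- `φ` is a phase function of `E`: continuous, strictly increasing, and `E(x) e^{i φ(x)}` is real
for every real `x`. -/
structure IsPhaseFunction (E : ℂ → ℂ) (φ : ℝ → ℝ) : Prop where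
  continuous : Continuous φ
  strictMono : StrictMono φ
  real : ∀ x : ℝ, (E x * Complex.exp (Complex.I * φ x)).im = 0

/-- The family `k` is complete in `H(E)`: every element of `H(E)` can be approximated in the norm
of `H(E)` by finite linear combinations of members of `k`. -/
def IsCompleteIn {ι : Type*} (E : ℂ → ℂ) (k : ι → ℂ → ℂ) : Prop :=
  ∀ h ∈ deBrangesSpace E, ∀ ε : ℝ≥0∞, 0 < ε →
    ∃ p ∈ Submodule.span ℂ (Set.range k), deBrangesNormSq E (h - p) < ε

/-- The multiplexed sample of `f` and `g` at the point `x`: `f(x) F(x) + g(x) E*(x)`. -/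
def multiplexedSample (E F f g : ℂ → ℂ) (x : ℂ) : ℂ :=
  f x * F x + g x * entireStar E x

end

/-!
The multiplexing map `(f, g) ↦ f F + g E*` is an isometry of `H(E) ⊕ H(F)` into `H(EF)`. Indeed
`|E*| = |E|` on the real line, and the inner product of the two summands is the complex
conjugate of the integral of `(f* / E) (g / F)`, a function of Hardy class `H¹` in the upper
half-plane, whose integral over the real line vanishes.

The membership in `H¹` has to be extracted from bounded type and nonpositive mean type. Writing
`u = P / Q` with `P` and `Q` bounded, Poisson–Jensen on discs exhausting the half-plane gives
`|u(z)| ≤ exp (1 + C Im z) · Poisson[|u|](z)`, and a Phragmén–Lindelöf argument using the mean type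
removes the exponential growth, so that the contour can be pushed to infinity.

The same vanishing yields the reproducing property of `K_E`. The multiplexing map sends
`(conj F(w) K_E(w, ·), E(conj w) K_F(w, ·))` to `K_EF(w, ·)`, and the phase condition makes the
kernels `K_EF(λ_n, ·)` orthogonal. Completeness therefore turns the orthogonal expansion of
`f F + g E*` into a convergent one, and the isometry splits it into expansions of `f` and `g`. Norm
convergence implies pointwise convergence because evaluation is bounded on a de Branges space.
-/

section PoissonJensen

variable {U Q : ℂ → ℂ} {R : ℝ} {w : ℂ}

theorem one_le_norm_canonicalFactor {a : ℂ} (ha : a ∈ Metric.ball (0 : ℂ) R)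
    (hw : w ∈ Metric.ball (0 : ℂ) R) (hne : w ≠ a) : 1 ≤ ‖Complex.canonicalFactor R a w‖ := by
  have hR : 0 < R := Metric.pos_of_mem_ball hw
  rw [mem_ball_zero_iff] at ha hw
  have hpos : 0 < ‖(R : ℂ) * (w - a)‖ := by simp [hR.ne', sub_eq_zero, hne]
  rw [Complex.canonicalFactor_apply, norm_div, one_le_div hpos]
  refine le_of_sq_le_sq ?_ (norm_nonneg _)
  rw [norm_mul, mul_pow, Complex.norm_real, Real.norm_eq_abs, sq_abs, Complex.sq_norm,
    Complex.sq_norm]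
  have haR : ‖a‖ ^ 2 ≤ R ^ 2 := by gcongr
  have hwR : ‖w‖ ^ 2 ≤ R ^ 2 := by gcongr
  rw [Complex.sq_norm] at haR hwR
  simp only [Complex.normSq_apply, Complex.sub_re, Complex.sub_im, Complex.mul_re, Complex.mul_im,
    Complex.conj_re, Complex.conj_im, ← Complex.ofReal_pow, Complex.ofReal_re,
    Complex.ofReal_im] at *
  nlinarith [mul_nonneg (sub_nonneg.2 haR) (sub_nonneg.2 hwR)]

theorem analytic_meromorphicOrderAt_eq_zero (hU : AnalyticAt ℂ U w) (hUw : U w ≠ 0) :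
    meromorphicOrderAt U w = 0 := by
  rw [hU.meromorphicOrderAt_eq, hU.analyticOrderAt_eq_zero.2 hUw]
  rfl

theorem exists_eCanonicalDecomp_of_ne_zero_on_sphere (hR : 0 < R)
    (hU : AnalyticOnNhd ℂ U (Metric.closedBall 0 R))
    (hS : ∀ ζ ∈ Metric.sphere (0 : ℂ) R, U ζ ≠ 0) :
    ∃ h, Nonempty (Complex.ECanonicalDecomp U h R) := by
  have hRS : (R : ℂ) ∈ Metric.sphere (0 : ℂ) R := by simp [hR.le]
  have hRB := Metric.sphere_subset_closedBall hRS
  have hord : ∀ u : Metric.closedBall (0 : ℂ) R, meromorphicOrderAt U u ≠ ⊤ := by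
    rw [← hU.meromorphicOn.exists_meromorphicOrderAt_ne_top_iff_forall
      ⟨⟨R, hRB⟩, (convex_closedBall 0 R).isPreconnected⟩]
    exact ⟨⟨R, hRB⟩, by simp [analytic_meromorphicOrderAt_eq_zero (hU R hRB) (hS R hRS)]⟩
  exact (hU.meromorphicOn.exists_ecanonicalDecomp hord).imp fun _ D => ⟨D⟩

theorem exists_zeroFree_majorant (hR : 0 < R) (hU : AnalyticOnNhd ℂ U (Metric.closedBall 0 R))
    (hS : ∀ ζ ∈ Metric.sphere (0 : ℂ) R, U ζ ≠ 0) :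
    ∃ h : ℂ → ℂ, AnalyticOnNhd ℂ h (Metric.closedBall 0 R) ∧
      (∀ ζ ∈ Metric.closedBall (0 : ℂ) R, h ζ ≠ 0) ∧
      (∀ ζ ∈ Metric.sphere (0 : ℂ) R, Real.log ‖h ζ‖ = Real.log ‖U ζ‖) ∧
      ∀ ζ ∈ Metric.ball (0 : ℂ) R, U ζ ≠ 0 → Real.log ‖U ζ‖ ≤ Real.log ‖h ζ‖ := by
  obtain ⟨h, ⟨D⟩⟩ := exists_eCanonicalDecomp_of_ne_zero_on_sphere hR hU hS
  have hdiv : MeromorphicOn.divisor U (Metric.sphere (0 : ℂ) R) = 0 := by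
    ext x
    by_cases hx : x ∈ Metric.sphere (0 : ℂ) R
    · rw [MeromorphicOn.divisor_apply (hU.meromorphicOn.mono_set Metric.sphere_subset_closedBall)
        hx, analytic_meromorphicOrderAt_eq_zero (hU x (Metric.sphere_subset_closedBall hx))
          (hS x hx)]
      rfl
    · exact Function.locallyFinsuppWithin.apply_eq_zero_of_notMem _ hx
  have hlog : ∀ ζ ∈ Metric.closedBall (0 : ℂ) R, U ζ ≠ 0 → Real.log ‖h ζ‖ =
      (∑ᶠ i, (MeromorphicOn.divisor U (Metric.ball 0 R) i) *
        Real.log ‖Complex.canonicalFactor R i ζ‖) + Real.log ‖U ζ‖ := fun ζ hζ hne => by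
    rw [D.log_norm_eq hζ (analytic_meromorphicOrderAt_eq_zero (hU ζ hζ) hne) hR, hdiv,
      (hU ζ hζ).meromorphicTrailingCoeffAt_of_ne_zero hne]
    simp
  refine ⟨h, D.analyticOnNhd, D.ne_zero, fun ζ hζ => ?_, fun ζ hζ hne => ?_⟩
  · rw [hlog ζ (Metric.sphere_subset_closedBall hζ) (hS ζ hζ), finsum_eq_zero_of_forall_eq_zero,
      zero_add]
    intro i
    by_cases hi : i ∈ Metric.ball (0 : ℂ) R
    · rw [Complex.norm_canonicalFactor_eval_circle_eq_one hi hζ, Real.log_one, mul_zero]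
    · simp [hi]
  · rw [hlog ζ (Metric.ball_subset_closedBall hζ) hne]
    refine le_add_of_nonneg_left (finsum_nonneg fun i => ?_)
    by_cases hi : i ∈ Metric.ball (0 : ℂ) R
    · rcases eq_or_ne ζ i with rfl | hζi
      · simp
      · exact mul_nonneg (mod_cast MeromorphicOn.AnalyticOnNhd.divisor_nonneg
          (hU.mono Metric.ball_subset_closedBall) i)
          (Real.log_nonneg (one_le_norm_canonicalFactor hi hζ hζi))
    · simp [hi]

theorem log_norm_le_circleAverage_poissonKernel
    (hU : AnalyticOnNhd ℂ U (Metric.closedBall 0 R)) (hw : w ∈ Metric.ball (0 : ℂ) R)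
    (hS : ∀ ζ ∈ Metric.sphere (0 : ℂ) R, U ζ ≠ 0) (hUw : U w ≠ 0) :
    Real.log ‖U w‖ ≤
      Real.circleAverage (fun ζ => poissonKernel 0 w ζ * Real.log ‖U ζ‖) 0 R := by
  have hR : 0 < R := Metric.pos_of_mem_ball hw
  obtain ⟨h, h_an, h_ne, h_sphere, h_ball⟩ := exists_zeroFree_majorant hR hU hS
  have hharm : InnerProductSpace.HarmonicOnNhd (fun ζ => Real.log ‖h ζ‖) (Metric.closedBall 0 R) :=
    fun ζ hζ => (h_an ζ hζ).harmonicAt_log_norm (h_ne ζ hζ)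
  refine (h_ball w hw hUw).trans ((hharm.circleAverage_poissonKernel_smul hw).symm.trans ?_).le
  refine Real.circleAverage_congr_sphere fun ζ hζ => ?_
  rw [abs_of_pos hR] at hζ
  simp only [Pi.smul_apply', smul_eq_mul, h_sphere ζ hζ]

theorem log_norm_center_le_circleAverage (hR : 0 < R)
    (hU : AnalyticOnNhd ℂ U (Metric.closedBall 0 R))
    (hS : ∀ ζ ∈ Metric.sphere (0 : ℂ) R, U ζ ≠ 0) (hU0 : U 0 ≠ 0) :
    Real.log ‖U 0‖ ≤ Real.circleAverage (fun ζ => Real.log ‖U ζ‖) 0 R := by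
  refine (log_norm_le_circleAverage_poissonKernel hU (Metric.mem_ball_self hR) hS hU0).trans
    (Real.circleAverage_congr_sphere fun ζ hζ => ?_).le
  have hζR : ‖ζ‖ ≠ 0 := by simp_all [hR.ne']
  simp [poissonKernel, hζR]

theorem continuousOn_poissonKernel : ContinuousOn (poissonKernel 0 w) {w}ᶜ := by
  unfold poissonKernel
  refine ContinuousOn.div (by fun_prop) (by fun_prop) fun z hz => ?_
  simpa [sub_eq_zero] using hz

theorem poissonKernel_nonneg {ζ : ℂ} (h : ‖w‖ ≤ ‖ζ‖) : 0 ≤ poissonKernel 0 w ζ := by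
  unfold poissonKernel
  have : ‖w‖ ^ 2 ≤ ‖ζ‖ ^ 2 := by gcongr
  exact div_nonneg (by simpa using this) (by positivity)

theorem norm_lt_norm_circleMap (hw : w ∈ Metric.ball (0 : ℂ) R) (θ : ℝ) :
    ‖w‖ < ‖circleMap 0 R θ‖ := by
  rw [norm_circleMap_zero, abs_of_pos (Metric.pos_of_mem_ball hw)]
  exact mem_ball_zero_iff.1 hw

theorem continuous_poissonKernel_circleMap (hw : w ∈ Metric.ball (0 : ℂ) R) :
    Continuous fun θ => poissonKernel 0 w (circleMap 0 R θ) :=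
  continuousOn_poissonKernel.comp_continuous (continuous_circleMap 0 R) fun θ h =>
    (norm_lt_norm_circleMap hw θ).ne (congrArg norm h.symm)

theorem continuous_log_norm_circleMap (hR : 0 ≤ R) (hU : ContinuousOn U (Metric.closedBall 0 R))
    (hS : ∀ ζ ∈ Metric.sphere (0 : ℂ) R, U ζ ≠ 0) :
    Continuous fun θ => Real.log ‖U (circleMap 0 R θ)‖ :=
  (hU.comp_continuous (continuous_circleMap 0 R) fun θ => circleMap_mem_closedBall 0 hR θ).norm.log
    fun θ => norm_ne_zero_iff.2 (hS _ (circleMap_mem_sphere 0 hR θ))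

theorem circleAverage_eq_arc_add_arc {f : ℂ → ℝ} (hf : Continuous fun θ => f (circleMap 0 R θ))
    (η : ℝ) : Real.circleAverage f 0 R = (2 * Real.pi)⁻¹ *
      ((∫ θ in (-η)..η, f (circleMap 0 R θ)) +
        ∫ θ in η..(2 * Real.pi - η), f (circleMap 0 R θ)) := by
  have hper : Function.Periodic (fun θ => f (circleMap 0 R θ)) (2 * Real.pi) := fun θ => by
    simp only [periodic_circleMap 0 R θ]
  rw [Real.circleAverage_def, smul_eq_mul, intervalIntegral.integral_add_adjacent_intervals
    (hf.intervalIntegrable _ _) (hf.intervalIntegrable _ _), sub_eq_neg_add,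
    ← hper.intervalIntegral_add_eq 0 (-η), zero_add]

theorem integral_arc_le_circleAverage {f : ℂ → ℝ} {η : ℝ}
    (hf : Continuous fun θ => f (circleMap 0 R θ)) (h0 : ∀ θ, 0 ≤ f (circleMap 0 R θ))
    (hη : η ≤ Real.pi) :
    ∫ θ in (-η)..η, f (circleMap 0 R θ) ≤ 2 * Real.pi * Real.circleAverage f 0 R := by
  rw [circleAverage_eq_arc_add_arc hf η, mul_inv_cancel_left₀ (by positivity)]
  exact le_add_of_nonneg_right (intervalIntegral.integral_nonneg (by linarith) fun θ _ => h0 θ)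

theorem integral_near_arc_poissonKernel_mul_log_le {η S m : ℝ}
    (hU : ContinuousOn U (Metric.closedBall 0 R)) (hQ : AnalyticOnNhd ℂ Q (Metric.closedBall 0 R))
    (hw : w ∈ Metric.ball (0 : ℂ) R) (hQ0 : Q 0 ≠ 0)
    (hU_ne : ∀ ζ ∈ Metric.sphere (0 : ℂ) R, U ζ ≠ 0)
    (hQ_ne : ∀ ζ ∈ Metric.sphere (0 : ℂ) R, Q ζ ≠ 0)
    (hUQ : ∀ ζ ∈ Metric.sphere (0 : ℂ) R, ‖U ζ * Q ζ‖ ≤ Real.exp m)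
    (hQ1 : ∀ ζ ∈ Metric.sphere (0 : ℂ) R, ‖Q ζ‖ ≤ 1) (hm : 0 ≤ m)
    (hη : 0 < η) (hηπ : η ≤ Real.pi)
    (hS : ∀ θ ∈ Set.Icc (-η) η, poissonKernel 0 w (circleMap 0 R θ) ≤ S) :
    ∫ θ in (-η)..η, poissonKernel 0 w (circleMap 0 R θ) * Real.log ‖U (circleMap 0 R θ)‖ ≤
      S * (2 * Real.pi * -Real.log ‖Q 0‖ + 2 * η * m) := by
  have hR : 0 < R := Metric.pos_of_mem_ball hw
  set γ := circleMap 0 R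
  have hγS : ∀ θ, γ θ ∈ Metric.sphere (0 : ℂ) R := circleMap_mem_sphere 0 hR.le
  have hker : ∀ θ, 0 ≤ poissonKernel 0 w (γ θ) := fun θ =>
    poissonKernel_nonneg (norm_lt_norm_circleMap hw θ).le
  have hlogQ_cont : Continuous fun θ => -Real.log ‖Q (γ θ)‖ :=
    (continuous_log_norm_circleMap hR.le hQ.continuousOn hQ_ne).neg
  have hlogQ : ∀ θ, 0 ≤ -Real.log ‖Q (γ θ)‖ := fun θ =>
    neg_nonneg.2 (Real.log_nonpos (norm_nonneg _) (hQ1 _ (hγS θ)))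
  have hlogU : ∀ θ, Real.log ‖U (γ θ)‖ ≤ -Real.log ‖Q (γ θ)‖ + m := fun θ => by
    have hU' := norm_pos_iff.2 (hU_ne _ (hγS θ))
    have hQ' := norm_pos_iff.2 (hQ_ne _ (hγS θ))
    have hle := hUQ _ (hγS θ)
    rw [norm_mul, ← Real.log_le_iff_le_exp (mul_pos hU' hQ'), Real.log_mul hU'.ne' hQ'.ne'] at hle
    linarith
  have hS0 : 0 ≤ S := (hker 0).trans (hS 0 ⟨by linarith, hη.le⟩)
  have hjensen : ∫ θ in (-η)..η, -Real.log ‖Q (γ θ)‖ ≤ 2 * Real.pi * -Real.log ‖Q 0‖ := by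
    refine (integral_arc_le_circleAverage (f := fun ζ => -Real.log ‖Q ζ‖) hlogQ_cont hlogQ
      hηπ).trans (mul_le_mul_of_nonneg_left ?_ (by positivity))
    have hcenter := log_norm_center_le_circleAverage hR hQ hQ_ne hQ0
    rw [Real.circleAverage_def] at hcenter ⊢
    rw [intervalIntegral.integral_neg, smul_neg]
    exact neg_le_neg hcenter
  calc _ ≤ ∫ θ in (-η)..η, S * (-Real.log ‖Q (γ θ)‖ + m) := by
        refine intervalIntegral.integral_mono_on (by linarith)
          (((continuous_poissonKernel_circleMap hw).mul
            (continuous_log_norm_circleMap hR.le hU hU_ne)).intervalIntegrable _ _)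
          ((hlogQ_cont.add_const m).const_mul S |>.intervalIntegrable _ _) fun θ hθ => ?_
        exact (mul_le_mul_of_nonneg_left (hlogU θ) (hker θ)).trans
          (mul_le_mul_of_nonneg_right (hS θ hθ) (add_nonneg (hlogQ θ) hm))
    _ = S * ((∫ θ in (-η)..η, -Real.log ‖Q (γ θ)‖) + 2 * η * m) := by
        rw [intervalIntegral.integral_const_mul, intervalIntegral.integral_add
          (hlogQ_cont.intervalIntegrable _ _) intervalIntegrable_const,
          intervalIntegral.integral_const, smul_eq_mul]
        ring
    _ ≤ _ := by gcongr

-- Near the positive real axis the bound comes from the denominator, since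
-- `log ‖U‖ ≤ m - log ‖Q‖` there; on the complementary arc it comes from `log ‖U‖ ≤ ‖U‖`.
theorem log_norm_le_of_arcs {η S m : ℝ}
    (hU : AnalyticOnNhd ℂ U (Metric.closedBall 0 R))
    (hQ : AnalyticOnNhd ℂ Q (Metric.closedBall 0 R))
    (hw : w ∈ Metric.ball (0 : ℂ) R) (hUw : U w ≠ 0) (hQ0 : Q 0 ≠ 0)
    (hU_ne : ∀ ζ ∈ Metric.sphere (0 : ℂ) R, U ζ ≠ 0)
    (hQ_ne : ∀ ζ ∈ Metric.sphere (0 : ℂ) R, Q ζ ≠ 0)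
    (hUQ : ∀ ζ ∈ Metric.sphere (0 : ℂ) R, ‖U ζ * Q ζ‖ ≤ Real.exp m)
    (hQ1 : ∀ ζ ∈ Metric.sphere (0 : ℂ) R, ‖Q ζ‖ ≤ 1) (hm : 0 ≤ m)
    (hη : 0 < η) (hηπ : η ≤ Real.pi)
    (hS : ∀ θ ∈ Set.Icc (-η) η, poissonKernel 0 w (circleMap 0 R θ) ≤ S) :
    Real.log ‖U w‖ ≤ S * (-Real.log ‖Q 0‖ + η / Real.pi * m) +
      (2 * Real.pi)⁻¹ * ∫ θ in η..(2 * Real.pi - η),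
        poissonKernel 0 w (circleMap 0 R θ) * ‖U (circleMap 0 R θ)‖ := by
  have hR : 0 < R := Metric.pos_of_mem_ball hw
  have hker := continuous_poissonKernel_circleMap hw
  have hlogU := continuous_log_norm_circleMap hR.le hU.continuousOn hU_ne
  have hnormU : Continuous fun θ => ‖U (circleMap 0 R θ)‖ :=
    (hU.continuousOn.comp_continuous (continuous_circleMap 0 R)
      (circleMap_mem_closedBall 0 hR.le)).norm
  have hnear := integral_near_arc_poissonKernel_mul_log_le hU.continuousOn hQ hw hQ0 hU_ne hQ_ne
    hUQ hQ1 hm hη hηπ hS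
  have hfar : ∫ θ in η..(2 * Real.pi - η),
        poissonKernel 0 w (circleMap 0 R θ) * Real.log ‖U (circleMap 0 R θ)‖ ≤
      ∫ θ in η..(2 * Real.pi - η), poissonKernel 0 w (circleMap 0 R θ) * ‖U (circleMap 0 R θ)‖ :=
    intervalIntegral.integral_mono_on (by linarith) ((hker.mul hlogU).intervalIntegrable _ _)
      ((hker.mul hnormU).intervalIntegrable _ _) fun θ _ =>
        mul_le_mul_of_nonneg_left (Real.log_le_self (norm_nonneg _))
          (poissonKernel_nonneg (norm_lt_norm_circleMap hw θ).le)
  calc _ ≤ _ := log_norm_le_circleAverage_poissonKernel hU hw hU_ne hUw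
    _ = _ := circleAverage_eq_arc_add_arc (hker.mul hlogU) η
    _ ≤ (2 * Real.pi)⁻¹ * (S * (2 * Real.pi * -Real.log ‖Q 0‖ + 2 * η * m) +
        ∫ θ in η..(2 * Real.pi - η),
          poissonKernel 0 w (circleMap 0 R θ) * ‖U (circleMap 0 R θ)‖) := by gcongr
    _ = _ := by field_simp

end PoissonJensen

section BoundaryLimit

theorem countable_zeros_of_analyticOnNhd {f : ℂ → ℂ} {S : Set ℂ} (hf : AnalyticOnNhd ℂ f S)
    (hS : IsPreconnected S) {x : ℂ} (hx : x ∈ S) (hfx : f x ≠ 0) :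
    {z ∈ S | f z = 0}.Countable := by
  refine (HereditarilyLindelofSpace.isLindelof _).countable_of_isDiscrete ?_
  rw [← Set.inter_self {z ∈ S | f z = 0}]
  refine isDiscrete_of_codiscreteWithin ?_
  filter_upwards [codiscreteWithin_mono (fun z hz => hz.1)
    (hf.preimage_zero_mem_codiscreteWithin hfx hx ⟨⟨x, hx⟩, hS⟩),
    self_mem_codiscreteWithin {z ∈ S | f z = 0}] with z hz hz'
  exact absurd hz'.2 (by simpa using hz)

theorem frequently_disjoint_sphere {Z : Set ℂ} (hZ : Z.Countable) (R : ℝ) :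
    ∃ᶠ r in 𝓝[<] R, Disjoint (Metric.sphere 0 r) Z := by
  intro h
  obtain ⟨l, hl, hsub⟩ := mem_nhdsLT_iff_exists_Ioo_subset.1 h
  obtain ⟨r, hr, hlr⟩ := ((hZ.image norm).dense_compl ℝ).exists_between hl
  refine hsub hlr (Set.disjoint_left.2 fun ζ hζ hζZ => hr ⟨ζ, hζZ, ?_⟩)
  exact mem_sphere_zero_iff_norm.1 hζ

theorem circleMap_ne_one {r θ : ℝ} (hr : 0 < r) (h0 : 0 < θ) (h1 : θ < 2 * Real.pi) :
    circleMap 0 r θ ≠ 1 := by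
  intro h
  obtain rfl : r = 1 := by simpa [abs_of_pos hr] using congrArg norm h
  have hθ : |θ - 0| < 2 * Real.pi := by rwa [sub_zero, abs_of_pos h0]
  exact h0.ne' (eq_of_circleMap_eq one_ne_zero hθ (by rw [h]; simp [circleMap]))

theorem norm_circleMap_sub_one_le {r : ℝ} (θ : ℝ) (hr : 0 ≤ r) (hr1 : r ≤ 1) :
    ‖circleMap 0 r θ - 1‖ ≤ (1 - r) + |θ| := by
  have hexp : ‖Complex.exp (Complex.I * θ) - 1‖ ≤ |θ| := by
    simpa using Real.norm_exp_I_mul_ofReal_sub_one_le (x := θ)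
  calc ‖circleMap 0 r θ - 1‖
      = ‖r * (Complex.exp (Complex.I * θ) - 1) - ((1 - r : ℝ) : ℂ)‖ := by
        rw [circleMap_zero, mul_comm Complex.I]; push_cast; ring_nf
    _ ≤ ‖(r : ℂ) * (Complex.exp (Complex.I * θ) - 1)‖ + ‖((1 - r : ℝ) : ℂ)‖ := norm_sub_le _ _
    _ ≤ 1 * |θ| + (1 - r) := by
        rw [norm_mul, Complex.norm_real, Complex.norm_real, Real.norm_of_nonneg hr,
          Real.norm_of_nonneg (by linarith)]
        gcongr
    _ = _ := by ring

theorem tendsto_intervalIntegral_of_continuousOn {G : ℝ × ℝ → ℝ} {r₀ R a b : ℝ} (hr : r₀ < R)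
    (hab : a ≤ b) (hG : ContinuousOn G (Set.Icc r₀ R ×ˢ Set.Icc a b)) :
    Tendsto (fun r => ∫ θ in a..b, G (r, θ)) (𝓝[<] R) (𝓝 (∫ θ in a..b, G (R, θ))) := by
  obtain ⟨M, hM⟩ := (isCompact_Icc.prod isCompact_Icc).exists_bound_of_continuousOn hG
  have hsub : Set.uIoc a b ⊆ Set.Icc a b := by
    rw [Set.uIoc_of_le hab]; exact Set.Ioc_subset_Icc_self
  have hev : ∀ᶠ r in 𝓝[<] R, r ∈ Set.Icc r₀ R := by
    filter_upwards [Ioo_mem_nhdsLT hr] with r hr using Set.Ioo_subset_Icc_self hr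
  refine intervalIntegral.tendsto_integral_filter_of_dominated_convergence (fun _ => M) ?_ ?_
    intervalIntegrable_const (ae_of_all _ fun θ hθ => ?_)
  · filter_upwards [hev] with r hr
    exact (hG.comp (f := fun θ => (r, θ)) (by fun_prop) fun θ hθ => ⟨hr, hsub hθ⟩)
      |>.aestronglyMeasurable measurableSet_uIoc
  · filter_upwards [hev] with r hr
    exact ae_of_all _ fun θ hθ => hM (r, θ) ⟨hr, hsub hθ⟩
  · refine (hG (R, θ) ⟨⟨hr.le, le_rfl⟩, hsub hθ⟩).tendsto.comp (tendsto_nhdsWithin_iff.2 ⟨?_, ?_⟩)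
    · exact (Continuous.tendsto (by fun_prop) R).mono_left nhdsWithin_le_nhds
    · filter_upwards [hev] with r hr using ⟨hr, hsub hθ⟩

variable {U Q : ℂ → ℂ} {w : ℂ}

theorem tendsto_integral_arc_poissonKernel_mul_norm {η : ℝ}
    (hU : ContinuousOn U (Metric.closedBall 0 1 \ {1})) (hw : w ∈ Metric.ball (0 : ℂ) 1)
    (hη : 0 < η) (hηπ : η ≤ Real.pi) :
    Tendsto (fun r => ∫ θ in η..(2 * Real.pi - η),
        poissonKernel 0 w (circleMap 0 r θ) * ‖U (circleMap 0 r θ)‖) (𝓝[<] 1)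
      (𝓝 (∫ θ in η..(2 * Real.pi - η),
        poissonKernel 0 w (circleMap 0 1 θ) * ‖U (circleMap 0 1 θ)‖)) := by
  have hw1 : ‖w‖ < 1 := mem_ball_zero_iff.1 hw
  have hr₀ : (‖w‖ + 1) / 2 < 1 := by linarith
  refine tendsto_intervalIntegral_of_continuousOn (G := fun p =>
    poissonKernel 0 w (circleMap 0 p.1 p.2) * ‖U (circleMap 0 p.1 p.2)‖) hr₀ (by linarith) ?_
  have hγ : Continuous fun p : ℝ × ℝ => circleMap 0 p.1 p.2 := by simp only [circleMap]; fun_prop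
  have hpos : ∀ r ∈ Set.Icc ((‖w‖ + 1) / 2) 1, 0 < r ∧ ‖w‖ < r := fun r hr =>
    ⟨by linarith [norm_nonneg w, hr.1], by linarith [hr.1]⟩
  refine (continuousOn_poissonKernel.comp hγ.continuousOn ?_).mul
    (hU.comp hγ.continuousOn ?_).norm
  · rintro ⟨r, θ⟩ ⟨hr, -⟩ h
    have := congrArg norm (Set.mem_singleton_iff.1 h)
    rw [norm_circleMap_zero, abs_of_pos (hpos r hr).1] at this
    exact (hpos r hr).2.ne' this
  · rintro ⟨r, θ⟩ ⟨hr, hθ⟩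
    refine ⟨?_, circleMap_ne_one (hpos r hr).1 (hη.trans_le hθ.1) (by linarith [hθ.2])⟩
    simpa [abs_of_pos (hpos r hr).1] using hr.2

theorem eventually_poissonKernel_near_arc_le {δ : ℝ} (hw : w ∈ Metric.ball (0 : ℂ) 1)
    (hδ : 0 < δ) : ∀ᶠ η in 𝓝[>] (0 : ℝ), ∀ᶠ r in 𝓝[<] (1 : ℝ), ∀ θ ∈ Set.Icc (-η) η,
      poissonKernel 0 w (circleMap 0 r θ) ≤ poissonKernel 0 w 1 + δ := by
  have hw1 : (1 : ℂ) ≠ w := by rintro rfl; simp at hw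
  obtain ⟨ρ, hρ, hclose⟩ := Metric.continuousAt_iff.1
    (continuousOn_poissonKernel.continuousAt (isOpen_compl_singleton.mem_nhds hw1)) δ hδ
  filter_upwards [Ioo_mem_nhdsGT (half_pos hρ)] with η hη
  filter_upwards [Ioo_mem_nhdsLT (show max 0 (1 - ρ / 2) < 1 by simpa using hρ)] with r hr θ hθ
  have hr0 : 0 < r := (le_max_left _ _).trans_lt hr.1
  have hrρ : 1 - ρ / 2 < r := (le_max_right _ _).trans_lt hr.1
  have hdist : dist (circleMap 0 r θ) 1 < ρ := by
    rw [dist_eq_norm]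
    linarith [norm_circleMap_sub_one_le θ hr0.le hr.2.le, abs_le.2 hθ, hη.2]
  have := hclose hdist
  rw [Real.dist_eq] at this
  linarith [(abs_lt.1 this).2]

theorem log_norm_le_of_closed_arcs {η S m : ℝ} (hU : AnalyticOnNhd ℂ U (Metric.ball 0 1))
    (hUc : ContinuousOn U (Metric.closedBall 0 1 \ {1}))
    (hQ : AnalyticOnNhd ℂ Q (Metric.ball 0 1))
    (hUQ : ∀ ζ ∈ Metric.ball (0 : ℂ) 1, ‖U ζ * Q ζ‖ ≤ Real.exp m)
    (hQ1 : ∀ ζ ∈ Metric.ball (0 : ℂ) 1, ‖Q ζ‖ ≤ 1) (hm : 0 ≤ m)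
    (hw : w ∈ Metric.ball (0 : ℂ) 1) (hUw : U w ≠ 0) (hQ0 : Q 0 ≠ 0)
    (hη : 0 < η) (hηπ : η ≤ Real.pi)
    (hS : ∀ᶠ r in 𝓝[<] (1 : ℝ), ∀ θ ∈ Set.Icc (-η) η,
      poissonKernel 0 w (circleMap 0 r θ) ≤ S) :
    Real.log ‖U w‖ ≤ S * (-Real.log ‖Q 0‖ + η / Real.pi * m) +
      (2 * Real.pi)⁻¹ * ∫ θ in η..(2 * Real.pi - η),
        poissonKernel 0 w (circleMap 0 1 θ) * ‖U (circleMap 0 1 θ)‖ := by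
  have hpre : IsPreconnected (Metric.ball (0 : ℂ) 1) := (convex_ball 0 1).isPreconnected
  have hzeros := (countable_zeros_of_analyticOnNhd hU hpre hw hUw).union
    (countable_zeros_of_analyticOnNhd hQ hpre (Metric.mem_ball_self one_pos) hQ0)
  refine ge_of_tendsto_of_frequently (tendsto_const_nhds.add
    ((tendsto_integral_arc_poissonKernel_mul_norm hUc hw hη hηπ).const_mul _)) ?_
  have hrw : ∀ᶠ r in 𝓝[<] (1 : ℝ), r ∈ Set.Ioo ‖w‖ 1 :=
    Ioo_mem_nhdsLT (mem_ball_zero_iff.1 hw)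
  refine ((frequently_disjoint_sphere hzeros 1).and_eventually (hrw.and hS)).mono ?_
  rintro r ⟨hdisj, ⟨hwr, hr1⟩, hSr⟩
  have hball : Metric.closedBall (0 : ℂ) r ⊆ Metric.ball 0 1 := Metric.closedBall_subset_ball hr1
  have hsphere : Metric.sphere (0 : ℂ) r ⊆ Metric.ball 0 1 :=
    Metric.sphere_subset_closedBall.trans hball
  exact log_norm_le_of_arcs (hU.mono hball) (hQ.mono hball) (mem_ball_zero_iff.2 hwr) hUw hQ0
    (fun ζ hζ h => Set.disjoint_left.1 hdisj hζ (Or.inl ⟨hsphere hζ, h⟩))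
    (fun ζ hζ h => Set.disjoint_left.1 hdisj hζ (Or.inr ⟨hsphere hζ, h⟩))
    (fun ζ hζ => hUQ ζ (hsphere hζ)) (fun ζ hζ => hQ1 ζ (hsphere hζ)) hm hη hηπ hSr

theorem log_norm_le_of_punctured_circle {m J : ℝ} (hU : AnalyticOnNhd ℂ U (Metric.ball 0 1))
    (hUc : ContinuousOn U (Metric.closedBall 0 1 \ {1}))
    (hQ : AnalyticOnNhd ℂ Q (Metric.ball 0 1))
    (hUQ : ∀ ζ ∈ Metric.ball (0 : ℂ) 1, ‖U ζ * Q ζ‖ ≤ Real.exp m)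
    (hQ1 : ∀ ζ ∈ Metric.ball (0 : ℂ) 1, ‖Q ζ‖ ≤ 1) (hm : 0 ≤ m)
    (hw : w ∈ Metric.ball (0 : ℂ) 1) (hUw : U w ≠ 0) (hQ0 : Q 0 ≠ 0)
    (hJ : ∀ η, 0 < η → η < Real.pi → ∫ θ in η..(2 * Real.pi - η),
      poissonKernel 0 w (circleMap 0 1 θ) * ‖U (circleMap 0 1 θ)‖ ≤ 2 * Real.pi * J) :
    Real.log ‖U w‖ ≤ poissonKernel 0 w 1 * -Real.log ‖Q 0‖ + J := by
  have hδ : ∀ δ > 0, Real.log ‖U w‖ ≤ (poissonKernel 0 w 1 + δ) * -Real.log ‖Q 0‖ + J := by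
    intro δ hδ
    have hlim : Tendsto (fun η : ℝ =>
        (poissonKernel 0 w 1 + δ) * (-Real.log ‖Q 0‖ + η / Real.pi * m) + J) (𝓝[>] 0)
        (𝓝 ((poissonKernel 0 w 1 + δ) * -Real.log ‖Q 0‖ + J)) :=
      (Continuous.tendsto' (by fun_prop) _ _ (by simp)).mono_left nhdsWithin_le_nhds
    refine ge_of_tendsto hlim ?_
    filter_upwards [eventually_poissonKernel_near_arc_le hw hδ, Ioo_mem_nhdsGT Real.pi_pos]
      with η hS hη
    refine (log_norm_le_of_closed_arcs hU hUc hQ hUQ hQ1 hm hw hUw hQ0 hη.1 hη.2.le hS).trans ?_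
    gcongr
    rw [inv_mul_le_iff₀ (by positivity)]
    exact hJ η hη.1 hη.2
  have hlim : Tendsto (fun δ : ℝ => (poissonKernel 0 w 1 + δ) * -Real.log ‖Q 0‖ + J) (𝓝[>] 0)
      (𝓝 (poissonKernel 0 w 1 * -Real.log ‖Q 0‖ + J)) :=
    (Continuous.tendsto' (by fun_prop) _ _ (by simp)).mono_left nhdsWithin_le_nhds
  exact ge_of_tendsto hlim (eventually_nhdsWithin_of_forall hδ)

end BoundaryLimit

section Cayley

variable {z₀ z : ℂ}

/-- The Cayley transform of the unit disc onto the upper half-plane that sends `0` to `z₀` and `1`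
to infinity. -/
noncomputable def cayley (z₀ ζ : ℂ) : ℂ := (z₀ - conj z₀ * ζ) / (1 - ζ)

/-- The inverse of the Cayley transform `cayley z₀`. -/
noncomputable def cayleyInv (z₀ z : ℂ) : ℂ := (z - z₀) / (z - conj z₀)

theorem cayley_zero (z₀ : ℂ) : cayley z₀ 0 = z₀ := by simp [cayley]

theorem sub_conj_ne_zero (hz₀ : 0 < z₀.im) (hz : 0 ≤ z.im) : z - conj z₀ ≠ 0 := fun h => by
  have := congrArg Complex.im h
  simp only [Complex.sub_im, Complex.conj_im, Complex.zero_im] at this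
  linarith

theorem ofReal_sub_ne_zero (hz : z.im ≠ 0) (t : ℝ) : (t : ℂ) - z ≠ 0 := fun h =>
  hz (by simpa using congrArg Complex.im h)

theorem cayley_cayleyInv (hz₀ : 0 < z₀.im) (hz : 0 ≤ z.im) : cayley z₀ (cayleyInv z₀ z) = z := by
  have hne := sub_conj_ne_zero hz₀ hz
  have hconj : z₀ - conj z₀ ≠ 0 := sub_conj_ne_zero hz₀ hz₀.le
  have hden : 1 - cayleyInv z₀ z = (z₀ - conj z₀) / (z - conj z₀) := by
    rw [cayleyInv, one_sub_div hne, sub_sub_sub_cancel_left]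
  rw [cayley, hden, cayleyInv]
  field_simp
  ring

theorem im_cayley (z₀ ζ : ℂ) : (cayley z₀ ζ).im = z₀.im * poissonKernel 0 ζ 1 := by
  rw [cayley, Complex.div_im, ← sub_div, poissonKernel_def, Complex.sq_norm, Complex.sq_norm,
    Complex.sq_norm, mul_div_assoc']
  simp only [Complex.normSq_apply, Complex.sub_im, Complex.sub_re, Complex.mul_im, Complex.mul_re,
    Complex.conj_im, Complex.conj_re, Complex.one_im, Complex.one_re, Complex.zero_im,
    Complex.zero_re]
  congr 1 <;> ring

theorem im_cayley_pos (hz₀ : 0 < z₀.im) {ζ : ℂ} (hζ : ζ ∈ Metric.ball (0 : ℂ) 1) :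
    0 < (cayley z₀ ζ).im := by
  rw [im_cayley, poissonKernel_def, sub_zero, sub_zero, norm_one]
  have hζ1 : ‖ζ‖ < 1 := mem_ball_zero_iff.1 hζ
  have hne : 1 - ζ ≠ 0 := sub_ne_zero.2 fun h => by simp [← h] at hζ1
  have hnum : 0 < 1 ^ 2 - ‖ζ‖ ^ 2 := by nlinarith [norm_nonneg ζ]
  positivity

theorem im_cayley_nonneg (hz₀ : 0 ≤ z₀.im) {ζ : ℂ} (hζ : ζ ∈ Metric.closedBall (0 : ℂ) 1) :
    0 ≤ (cayley z₀ ζ).im := by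
  rw [im_cayley]
  exact mul_nonneg hz₀ (poissonKernel_nonneg (by simpa using hζ))

theorem differentiableAt_cayley (z₀ : ℂ) {ζ : ℂ} (hζ : ζ ≠ 1) :
    DifferentiableAt ℂ (cayley z₀) ζ := by
  have hne : 1 - ζ ≠ 0 := sub_ne_zero.2 hζ.symm
  unfold cayley
  fun_prop (disch := exact hne)

theorem analyticOnNhd_cayley (z₀ : ℂ) : AnalyticOnNhd ℂ (cayley z₀) (Metric.ball 0 1) :=
  DifferentiableOn.analyticOnNhd (fun ζ hζ => (differentiableAt_cayley z₀ (by
    rintro rfl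
    simp at hζ)).differentiableWithinAt) Metric.isOpen_ball

theorem one_sub_norm_cayleyInv_sq (hz₀ : 0 < z₀.im) (hz : 0 ≤ z.im) :
    1 - ‖cayleyInv z₀ z‖ ^ 2 = 4 * z.im * z₀.im / ‖z - conj z₀‖ ^ 2 := by
  have hne : ‖z - conj z₀‖ ^ 2 ≠ 0 := by simpa using sub_conj_ne_zero hz₀ hz
  rw [cayleyInv, norm_div, div_pow, one_sub_div hne]
  congr 1
  rw [Complex.sq_norm, Complex.sq_norm, Complex.normSq_apply, Complex.normSq_apply]
  simp only [Complex.sub_re, Complex.sub_im, Complex.conj_re, Complex.conj_im]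
  ring

theorem cayleyInv_mem_ball (hz₀ : 0 < z₀.im) (hz : 0 < z.im) :
    cayleyInv z₀ z ∈ Metric.ball (0 : ℂ) 1 := by
  have hpos : 0 < 4 * z.im * z₀.im / ‖z - conj z₀‖ ^ 2 := by
    have := norm_pos_iff.2 (sub_conj_ne_zero hz₀ hz.le)
    positivity
  rw [← one_sub_norm_cayleyInv_sq hz₀ hz.le] at hpos
  rw [mem_ball_zero_iff]
  nlinarith [norm_nonneg (cayleyInv z₀ z)]

theorem poissonKernel_cayleyInv (hz₀ : 0 < z₀.im) (hz : 0 < z.im) (t : ℝ) :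
    poissonKernel 0 (cayleyInv z₀ z) (cayleyInv z₀ t) =
      z.im * ‖(t : ℂ) - z₀‖ ^ 2 / (z₀.im * ‖(t : ℂ) - z‖ ^ 2) := by
  have hzne := sub_conj_ne_zero hz₀ hz.le
  have htne : (t : ℂ) - conj z₀ ≠ 0 := sub_conj_ne_zero hz₀ (by simp)
  have hconj : ‖z₀ - conj z₀‖ = 2 * z₀.im := by
    rw [Complex.sub_conj, norm_mul, Complex.norm_I, mul_one, Complex.norm_real,
      Real.norm_of_nonneg (by linarith)]
  have hnorm : ‖(t : ℂ) - conj z₀‖ = ‖(t : ℂ) - z₀‖ := by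
    rw [← Complex.norm_conj, map_sub, Complex.conj_conj, Complex.conj_ofReal]
  have hcircle : ‖cayleyInv z₀ t‖ ^ 2 = 1 := by
    have := one_sub_norm_cayleyInv_sq hz₀ (z := t) (by simp)
    simp only [Complex.ofReal_im, mul_zero, zero_mul, zero_div] at this
    linarith
  have hsub : cayleyInv z₀ t - cayleyInv z₀ z =
      (z₀ - conj z₀) * (t - z) / ((t - conj z₀) * (z - conj z₀)) := by
    rw [cayleyInv, cayleyInv]
    field_simp
    ring
  have hzne' := norm_ne_zero_iff.2 hzne
  have htz := norm_ne_zero_iff.2 (ofReal_sub_ne_zero hz.ne' t)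
  rw [poissonKernel_def, sub_zero, sub_zero, hcircle, one_sub_norm_cayleyInv_sq hz₀ hz.le, hsub,
    norm_div, norm_mul, norm_mul, hnorm, hconj]
  have ht₀ := norm_ne_zero_iff.2 (ofReal_sub_ne_zero hz₀.ne' t)
  field_simp
  ring

/-- The boundary point `cayley z₀ (exp (i θ)) = z₀.re - z₀.im * cot (θ / 2)` of the upper
half-plane, as a function of the angle. -/
noncomputable def circleParam (z₀ : ℂ) (θ : ℝ) : ℝ :=
  z₀.re - z₀.im * (Real.cos (θ / 2) / Real.sin (θ / 2))

theorem circleMap_eq_cayleyInv_circleParam (hz₀ : 0 < z₀.im) {θ : ℝ}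
    (hθ : Real.sin (θ / 2) ≠ 0) : circleMap 0 1 θ = cayleyInv z₀ (circleParam z₀ θ) := by
  have hsin : Complex.sin (θ / 2) ≠ 0 := by exact_mod_cast hθ
  have hexp : circleMap 0 1 θ = Complex.exp (θ / 2 * Complex.I) ^ 2 := by
    rw [circleMap_zero, ← Complex.exp_nat_mul, Complex.ofReal_one, one_mul]
    congr 1
    push_cast
    ring
  have hne : (circleParam z₀ θ : ℂ) - conj z₀ ≠ 0 := sub_conj_ne_zero hz₀ (by simp)
  have hparam : (circleParam z₀ θ : ℂ) =
      z₀.re - z₀.im * (Complex.cos (θ / 2) / Complex.sin (θ / 2)) := by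
    simp [circleParam]
  have hden : (circleParam z₀ θ : ℂ) - conj z₀ =
      -(z₀.im / Complex.sin (θ / 2)) * (Complex.cos (θ / 2) - Complex.sin (θ / 2) * Complex.I) := by
    rw [hparam, show conj z₀ = z₀.re - z₀.im * Complex.I by apply Complex.ext <;> simp]
    field_simp
    ring
  have hnum : (circleParam z₀ θ : ℂ) - z₀ =
      -(z₀.im / Complex.sin (θ / 2)) * (Complex.cos (θ / 2) + Complex.sin (θ / 2) * Complex.I) := by
    nth_rewrite 2 [← Complex.re_add_im z₀]
    rw [hparam]
    field_simp
    ring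
  rw [cayleyInv, eq_div_iff hne, hexp, Complex.exp_mul_I, hden, hnum]
  linear_combination -(z₀.im / Complex.sin (θ / 2)) *
    (Complex.cos (θ / 2) + Complex.sin (θ / 2) * Complex.I) *
    (Complex.sin_sq_add_cos_sq (θ / 2) - Complex.sin (θ / 2) ^ 2 * Complex.I_sq)

theorem sin_half_pos {θ : ℝ} (h0 : 0 < θ) (h1 : θ < 2 * Real.pi) : 0 < Real.sin (θ / 2) :=
  Real.sin_pos_of_pos_of_lt_pi (by linarith) (by linarith)

theorem hasDerivAt_circleParam (z₀ : ℂ) {θ : ℝ} (hθ : Real.sin (θ / 2) ≠ 0) :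
    HasDerivAt (circleParam z₀) (‖(circleParam z₀ θ : ℂ) - z₀‖ ^ 2 / (2 * z₀.im)) θ := by
  have hhalf : HasDerivAt (fun x : ℝ => x / 2) (1 / 2) θ := (hasDerivAt_id θ).div_const 2
  refine ((hhalf.cos.div hhalf.sin hθ).const_mul z₀.im).const_sub z₀.re |>.congr_deriv ?_
  rw [Complex.sq_norm, Complex.normSq_apply, circleParam]
  simp only [Complex.sub_re, Complex.sub_im, Complex.ofReal_re, Complex.ofReal_im]
  rcases eq_or_ne z₀.im 0 with h0 | h0
  · simp [h0]
  · field_simp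
    ring

theorem circleParam_le_circleParam_two_pi_sub (hz₀ : 0 ≤ z₀.im) {η : ℝ} (hη : 0 ≤ η)
    (hηπ : η ≤ Real.pi) : circleParam z₀ η ≤ circleParam z₀ (2 * Real.pi - η) := by
  have hhalf : (2 * Real.pi - η) / 2 = Real.pi - η / 2 := by ring
  have hsin : 0 ≤ Real.sin (η / 2) := Real.sin_nonneg_of_nonneg_of_le_pi (by linarith) (by linarith)
  have hcos : 0 ≤ Real.cos (η / 2) := Real.cos_nonneg_of_mem_Icc ⟨by linarith, by linarith⟩
  rw [circleParam, circleParam, hhalf, Real.cos_pi_sub, Real.sin_pi_sub, neg_div, mul_neg]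
  linarith [mul_nonneg hz₀ (div_nonneg hcos hsin)]

end Cayley

section PoissonIntegral

variable {f : ℝ → ℝ} {z z₀ : ℂ}

/-- The Poisson integral in the upper half-plane of a function on the real line. -/
noncomputable def poissonIntegral (f : ℝ → ℝ) (z : ℂ) : ℝ :=
  z.im / Real.pi * ∫ t : ℝ, f t / ‖(t : ℂ) - z‖ ^ 2

theorem abs_im_le_norm_ofReal_sub (t : ℝ) (z : ℂ) : |z.im| ≤ ‖(t : ℂ) - z‖ := by
  simpa using Complex.abs_im_le_norm ((t : ℂ) - z)

theorem integrable_div_norm_sub_sq (hf : Integrable f) (hz : z.im ≠ 0) :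
    Integrable fun t : ℝ => f t / ‖(t : ℂ) - z‖ ^ 2 := by
  refine (hf.norm.div_const (z.im ^ 2)).mono'
    (hf.aestronglyMeasurable.div₀ (Measurable.aestronglyMeasurable (by fun_prop)))
    (ae_of_all _ fun t => ?_)
  rw [norm_div, norm_pow, norm_norm, ← sq_abs z.im]
  gcongr
  exact abs_im_le_norm_ofReal_sub t z

theorem poissonIntegral_nonneg (hf : 0 ≤ f) (hz : 0 ≤ z.im) : 0 ≤ poissonIntegral f z :=
  mul_nonneg (by positivity) (integral_nonneg fun t => div_nonneg (hf t) (by positivity))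

theorem poissonIntegral_le (hf : Integrable f) (hf0 : 0 ≤ f) (hz : 0 < z.im) :
    poissonIntegral f z ≤ (∫ t, f t) / (Real.pi * z.im) := by
  have hle : ∫ t : ℝ, f t / ‖(t : ℂ) - z‖ ^ 2 ≤ (∫ t, f t) / z.im ^ 2 := by
    rw [← integral_div]
    refine integral_mono (integrable_div_norm_sub_sq hf hz.ne') (hf.div_const _) fun t => ?_
    have := hf0 t
    have hzt := abs_im_le_norm_ofReal_sub t z
    rw [abs_of_pos hz] at hzt
    dsimp only
    gcongr
  calc poissonIntegral f z ≤ z.im / Real.pi * ((∫ t, f t) / z.im ^ 2) := by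
        rw [poissonIntegral]
        gcongr
    _ = (∫ t, f t) / (Real.pi * z.im) := by
        field_simp

theorem ofReal_poissonIntegral (hf : Integrable f) (hf0 : 0 ≤ f) {y : NNReal} (hy : y ≠ 0) (x : ℝ) :
    ENNReal.ofReal (poissonIntegral f (x + y * Complex.I)) =
      ∫⁻ t, ENNReal.ofReal (f t) * ProbabilityTheory.cauchyPDF t y x := by
  have him : ((x : ℂ) + (y : ℝ) * Complex.I).im = y := by simp
  have hnorm (t : ℝ) : ‖(t : ℂ) - (x + (y : ℝ) * Complex.I)‖ ^ 2 = (x - t) ^ 2 + y ^ 2 := by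
    rw [Complex.sq_norm, Complex.normSq_apply]
    simp
    ring
  rw [poissonIntegral, ← integral_const_mul, ofReal_integral_eq_lintegral_ofReal
    ((integrable_div_norm_sub_sq hf (by simpa using hy)).const_mul _)
    (ae_of_all _ fun t => mul_nonneg (by rw [him]; positivity)
      (div_nonneg (hf0 t) (by positivity)))]
  refine lintegral_congr fun t => ?_
  rw [ProbabilityTheory.cauchyPDF_def, ← ENNReal.ofReal_mul (hf0 t),
    ProbabilityTheory.cauchyPDFReal_def, hnorm, him]
  congr 1
  field_simp

theorem lintegral_poissonIntegral (hf : Integrable f) (hf0 : 0 ≤ f) {y : ℝ} (hy : 0 < y) :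
    ∫⁻ x : ℝ, ENNReal.ofReal (poissonIntegral f (x + y * Complex.I)) =
      ∫⁻ t, ENNReal.ofReal (f t) := by
  lift y to NNReal using hy.le
  have hy0 : y ≠ 0 := by exact_mod_cast hy.ne'
  have hpdf : Measurable fun p : ℝ × ℝ => ProbabilityTheory.cauchyPDF p.2 y p.1 := by
    simp only [ProbabilityTheory.cauchyPDF_def, ProbabilityTheory.cauchyPDFReal_def]
    fun_prop
  simp only [ofReal_poissonIntegral hf hf0 hy0]
  rw [lintegral_lintegral_swap
    (hf.aemeasurable.ennreal_ofReal.comp_snd.mul hpdf.aemeasurable)]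
  refine lintegral_congr fun t => ?_
  rw [lintegral_const_mul _ (ProbabilityTheory.measurable_cauchyPDF t y),
    ProbabilityTheory.lintegral_cauchyPDF_eq_one t hy0, mul_one]

theorem integral_arc_poissonKernel_mul_circleParam_le (hf : Integrable f) (hf0 : 0 ≤ f)
    (hz₀ : 0 < z₀.im) (hz : 0 < z.im) {η : ℝ} (hη : 0 < η) (hηπ : η < Real.pi) :
    ∫ θ in η..(2 * Real.pi - η),
      poissonKernel 0 (cayleyInv z₀ z) (circleMap 0 1 θ) * f (circleParam z₀ θ) ≤
        2 * Real.pi * poissonIntegral f z := by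
  set g : ℝ → ℝ := fun t => 2 * z.im * (f t / ‖(t : ℂ) - z‖ ^ 2) with hg
  have hsin : ∀ θ ∈ Set.uIcc η (2 * Real.pi - η), Real.sin (θ / 2) ≠ 0 := fun θ hθ => by
    rw [Set.uIcc_of_le (by linarith)] at hθ
    exact (sin_half_pos (hη.trans_le hθ.1) (by linarith [hθ.2])).ne'
  have hderiv : ∀ θ ∈ Set.uIcc η (2 * Real.pi - η), HasDerivAt (circleParam z₀)
      (‖(circleParam z₀ θ : ℂ) - z₀‖ ^ 2 / (2 * z₀.im)) θ := fun θ hθ =>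
    hasDerivAt_circleParam z₀ (hsin θ hθ)
  have hle := circleParam_le_circleParam_two_pi_sub hz₀.le hη.le hηπ.le
  calc ∫ θ in η..(2 * Real.pi - η),
        poissonKernel 0 (cayleyInv z₀ z) (circleMap 0 1 θ) * f (circleParam z₀ θ)
      = ∫ θ in η..(2 * Real.pi - η),
          (g ∘ circleParam z₀) θ * (‖(circleParam z₀ θ : ℂ) - z₀‖ ^ 2 / (2 * z₀.im)) := by
        refine intervalIntegral.integral_congr fun θ hθ => ?_
        simp only [Function.comp, hg]
        rw [circleMap_eq_cayleyInv_circleParam hz₀ (hsin θ hθ), poissonKernel_cayleyInv hz₀ hz]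
        field_simp
    _ = ∫ t in circleParam z₀ η..circleParam z₀ (2 * Real.pi - η), g t :=
        intervalIntegral.integral_comp_mul_deriv_of_deriv_nonneg
          (fun θ hθ => (hderiv θ hθ).continuousAt.continuousWithinAt)
          (fun θ hθ => hderiv θ (Set.Ioo_subset_Icc_self hθ)) fun θ _ => by positivity
    _ ≤ ∫ t, g t := by
        rw [intervalIntegral.integral_of_le hle]
        exact setIntegral_le_integral ((integrable_div_norm_sub_sq hf hz.ne').const_mul _)
          (ae_of_all _ fun t => mul_nonneg (by positivity) (div_nonneg (hf0 t) (by positivity)))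
    _ = 2 * Real.pi * poissonIntegral f z := by
        rw [poissonIntegral, integral_const_mul]
        field_simp

theorem poissonIntegral_div_const (f : ℝ → ℝ) (c : ℝ) (z : ℂ) :
    poissonIntegral (fun t => f t / c) z = poissonIntegral f z / c := by
  simp only [poissonIntegral, div_right_comm _ c, integral_div, mul_div_assoc]

theorem log_norm_le_neg_log_mul_im_add_poissonIntegral {u Q : ℂ → ℂ} {m : ℝ}
    (hu : AnalyticOnNhd ℂ u {z | 0 ≤ z.im}) (hQ : DifferentiableOn ℂ Q {z | 0 < z.im})
    (huQ : ∀ z : ℂ, 0 < z.im → ‖u z * Q z‖ ≤ Real.exp m) (hQ1 : ∀ z : ℂ, 0 < z.im → ‖Q z‖ ≤ 1)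
    (hm : 0 ≤ m) (hint : Integrable fun t : ℝ => u t) (hz₀ : 0 < z₀.im) (hQz₀ : Q z₀ ≠ 0)
    (hz : 0 < z.im) (huz : u z ≠ 0) :
    Real.log ‖u z‖ ≤ -Real.log ‖Q z₀‖ / z₀.im * z.im + poissonIntegral (fun t => ‖u t‖) z := by
  have himpos : Set.MapsTo (cayley z₀) (Metric.ball 0 1) {z | 0 < z.im} := fun ζ hζ =>
    im_cayley_pos hz₀ hζ
  have himnonneg : Set.MapsTo (cayley z₀) (Metric.closedBall 0 1 \ {1}) {z | 0 ≤ z.im} :=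
    fun ζ hζ => im_cayley_nonneg hz₀.le hζ.1
  have hw := cayley_cayleyInv hz₀ hz.le
  have hkernel : poissonKernel 0 (cayleyInv z₀ z) 1 = z.im / z₀.im := by
    rw [eq_div_iff hz₀.ne', mul_comm, ← im_cayley, hw]
  have hlog := log_norm_le_of_punctured_circle (U := u ∘ cayley z₀) (Q := Q ∘ cayley z₀)
    (w := cayleyInv z₀ z) (J := poissonIntegral (fun t => ‖u t‖) z)
    (hu.comp (analyticOnNhd_cayley z₀) fun ζ hζ => Set.mem_ofPred_eq ▸ (himpos hζ).le)
    (hu.continuousOn.comp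
      (fun ζ hζ => (differentiableAt_cayley z₀ hζ.2).continuousAt.continuousWithinAt) himnonneg)
    ((hQ.analyticOnNhd (isOpen_lt continuous_const Complex.continuous_im)).comp
      (analyticOnNhd_cayley z₀) himpos)
    (fun ζ hζ => huQ _ (himpos hζ)) (fun ζ hζ => hQ1 _ (himpos hζ)) hm (cayleyInv_mem_ball hz₀ hz)
    (by simpa only [Function.comp_apply, hw] using huz)
    (by simpa only [Function.comp_apply, cayley_zero] using hQz₀) fun η hη hηπ => ?_
  · simp only [Function.comp_apply, hw, cayley_zero, hkernel] at hlog
    linear_combination hlog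
  · refine le_of_eq_of_le (intervalIntegral.integral_congr fun θ hθ => ?_)
      (integral_arc_poissonKernel_mul_circleParam_le hint.norm (fun t => norm_nonneg _) hz₀ hz
        hη hηπ)
    rw [Set.uIcc_of_le (by linarith)] at hθ
    have hsin := sin_half_pos (hη.trans_le hθ.1) (by linarith [hθ.2])
    simp only [circleMap_eq_cayleyInv_circleParam hz₀ hsin.ne', Function.comp_apply]
    rw [cayley_cayleyInv hz₀ (by simp)]

-- Only `log x ≤ x` relates `log |u|` to `|u|` on the real line; dividing `u` by `c` makes it sharp.
theorem norm_le_exp_mul_poissonIntegral {u Q : ℂ → ℂ}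
    (hu : AnalyticOnNhd ℂ u {z | 0 ≤ z.im}) (hQ : DifferentiableOn ℂ Q {z | 0 < z.im})
    (huQ : ∀ z : ℂ, 0 < z.im → ‖u z * Q z‖ ≤ 1) (hQ1 : ∀ z : ℂ, 0 < z.im → ‖Q z‖ ≤ 1)
    (hint : Integrable fun t : ℝ => u t) (hz₀ : 0 < z₀.im) (hQz₀ : Q z₀ ≠ 0) (hz : 0 < z.im) :
    ‖u z‖ ≤ Real.exp (1 + -Real.log ‖Q z₀‖ / z₀.im * z.im) *
      poissonIntegral (fun t => ‖u t‖) z := by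
  have hp0 : 0 ≤ poissonIntegral (fun t => ‖u t‖) z :=
    poissonIntegral_nonneg (fun t => norm_nonneg _) hz.le
  rcases eq_or_ne (u z) 0 with huz | huz
  · rw [huz, norm_zero]
    positivity
  suffices h : ∀ c, poissonIntegral (fun t => ‖u t‖) z < c →
      ‖u z‖ ≤ Real.exp (1 + -Real.log ‖Q z₀‖ / z₀.im * z.im) * c from
    ge_of_tendsto (x := 𝓝[>] poissonIntegral (fun t => ‖u t‖) z)
      ((continuous_const_mul _).tendsto' _ _ rfl |>.mono_left nhdsWithin_le_nhds)
      (eventually_nhdsWithin_of_forall h)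
  intro c hc
  have hc0 : 0 < c := hp0.trans_lt hc
  have hcne : (c : ℂ) ≠ 0 := by exact_mod_cast hc0.ne'
  have hnorm (w : ℂ) : ‖w / c‖ = ‖w‖ / c := by
    rw [norm_div, Complex.norm_real, Real.norm_of_nonneg hc0.le]
  have hbound (z : ℂ) (hz : 0 < z.im) : ‖u z / c * Q z‖ ≤ Real.exp c⁻¹ := by
    calc ‖u z / c * Q z‖ = ‖u z * Q z‖ / c := by rw [div_mul_eq_mul_div, hnorm]
      _ ≤ c⁻¹ := by
          rw [← one_div]
          gcongr
          exact huQ z hz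
      _ ≤ Real.exp c⁻¹ := by linarith [Real.add_one_le_exp c⁻¹]
  have hlog := log_norm_le_neg_log_mul_im_add_poissonIntegral (u := fun z => u z / c)
    (hu.div analyticOnNhd_const fun _ _ => hcne) hQ hbound hQ1 (by positivity) (hint.div_const _)
    hz₀ hQz₀ hz (div_ne_zero huz hcne)
  simp only [hnorm, poissonIntegral_div_const] at hlog
  have hone : poissonIntegral (fun t => ‖u t‖) z / c ≤ 1 := (div_le_one hc0).2 hc.le
  rw [← div_le_iff₀ hc0, ← Real.log_le_iff_le_exp (div_pos (norm_pos_iff.2 huz) hc0)]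
  linarith

theorem IsBoundedType.exists_norm_le_exp_mul_poissonIntegral {u : ℂ → ℂ} (hbt : IsBoundedType u)
    (hu : AnalyticOnNhd ℂ u {z | 0 ≤ z.im}) (hint : Integrable fun t : ℝ => u t) :
    ∃ C : ℝ, 0 ≤ C ∧ ∀ z : ℂ, 0 < z.im →
      ‖u z‖ ≤ Real.exp (1 + C * z.im) * poissonIntegral (fun t => ‖u t‖) z := by
  obtain ⟨-, P, Q, -, hQ, ⟨M, hM⟩, ⟨z₀, hz₀, hQz₀⟩, huQ⟩ := hbt
  set N := max M 1
  have hN0 : 0 < N := lt_max_of_lt_right one_pos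
  have hbound : ∀ w : ℂ, ‖w‖ ≤ M → ‖w / N‖ ≤ 1 := fun w hw => by
    rw [norm_div, Complex.norm_real, Real.norm_of_nonneg hN0.le, div_le_one hN0]
    exact hw.trans (le_max_left _ _)
  refine ⟨-Real.log ‖Q z₀ / N‖ / z₀.im, div_nonneg (neg_nonneg.2 (Real.log_nonpos (norm_nonneg _)
    (hbound _ (hM z₀ hz₀).2))) hz₀.le, fun z hz => ?_⟩
  refine norm_le_exp_mul_poissonIntegral (Q := fun z => Q z / N) hu (hQ.div_const _)
    (fun z hz => ?_) (fun z hz => hbound _ (hM z hz).2) hint hz₀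
    (div_ne_zero hQz₀ (by exact_mod_cast hN0.ne')) hz
  rw [mul_div_assoc', huQ z hz]
  exact hbound _ (hM z hz).1

end PoissonIntegral

section MeanType

variable {u : ℂ → ℂ}

theorem meanType_nonpos_iff : meanType u ≤ 0 ↔
    ∀ ε : ℝ, 0 < ε → ∀ᶠ y : ℝ in atTop, ‖u (y * Complex.I)‖ ≤ Real.exp (ε * y) := by
  have hdiv_le : ∀ ε y : ℝ, 0 < y →
      (ENNReal.log ‖u (y * Complex.I)‖ₑ / (y : EReal) ≤ ε ↔
        ‖u (y * Complex.I)‖ ≤ Real.exp (ε * y)) := by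
    intro ε y hy
    rw [EReal.div_le_iff_le_mul (by exact_mod_cast hy) (EReal.coe_ne_top _), ← EReal.coe_mul,
      ← Real.log_exp (y * ε), ← ENNReal.log_ofReal_of_pos (Real.exp_pos _),
      ENNReal.log_le_log_iff, ← ofReal_norm, ENNReal.ofReal_le_ofReal_iff (Real.exp_nonneg _),
      mul_comm y]
  rw [meanType, limsup_le_iff']
  constructor
  · intro h ε hε
    filter_upwards [h ε (by exact_mod_cast hε), eventually_gt_atTop 0] with y hy hy0
    exact (hdiv_le ε y hy0).1 hy
  · intro h b hb
    obtain ⟨ε, hε, hεb⟩ := EReal.lt_iff_exists_real_btwn.1 hb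
    filter_upwards [h ε (by exact_mod_cast hε), eventually_gt_atTop 0] with y hy hy0
    exact ((hdiv_le ε y hy0).2 hy).trans hεb.le

theorem norm_le_of_subexponential_on_real {f : ℂ → ℂ} {K : ℝ}
    (hd : DiffContOnCl ℂ f {z | 0 < z.re})
    (hexp : ∃ c < (2 : ℝ), ∃ B, f =O[Bornology.cobounded ℂ ⊓ 𝓟 {z | 0 < z.re}]
      fun z => Real.exp (B * ‖z‖ ^ c))
    (hre : ∀ ε : ℝ, 0 < ε → ∀ᶠ x : ℝ in atTop, ‖f x‖ ≤ Real.exp (ε * x))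
    (him : ∀ x : ℝ, ‖f (x * Complex.I)‖ ≤ K) {z : ℂ} (hz : 0 ≤ z.re) : ‖f z‖ ≤ K := by
  have hnorm (ε : ℝ) (z : ℂ) :
      ‖Complex.exp (-ε * z) * f z‖ = Real.exp (-ε * z.re) * ‖f z‖ := by
    simp [Complex.norm_exp]
  have hε : ∀ ε : ℝ, 0 < ε → ‖Complex.exp (-ε * z) * f z‖ ≤ K := by
    intro ε hε
    refine PhragmenLindelof.right_half_plane_of_bounded_on_real
      (f := fun z => Complex.exp (-ε * z) * f z)
      ((Differentiable.diffContOnCl (f := fun z => Complex.exp (-ε * z)) (by fun_prop)).smul hd)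
      ?_ ⟨1, eventually_map.2 ?_⟩ (fun x => ?_) hz
    · obtain ⟨c, hc, B, hB⟩ := hexp
      refine ⟨c, hc, B, (Asymptotics.IsBigO.of_bound' ?_).trans hB⟩
      refine eventually_inf_principal.2 (Eventually.of_forall fun ζ (hζ : 0 < ζ.re) => ?_)
      rw [hnorm]
      refine mul_le_of_le_one_left (norm_nonneg _) (Real.exp_le_one_iff.2 ?_)
      nlinarith
    · filter_upwards [hre ε hε] with x hx
      rw [hnorm, Complex.ofReal_re]
      calc _ ≤ Real.exp (-ε * x) * Real.exp (ε * x) := by gcongr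
        _ = 1 := by rw [← Real.exp_add]; simp
    · rw [hnorm]
      simpa using him x
  have hlim : Tendsto (fun ε : ℝ => ‖Complex.exp (-ε * z) * f z‖) (𝓝[>] 0) (𝓝 ‖f z‖) :=
    (Continuous.tendsto' (by fun_prop) _ _ (by simp)).mono_left nhdsWithin_le_nhds
  exact le_of_tendsto hlim (eventually_nhdsWithin_of_forall hε)

theorem norm_le_of_meanType_nonpos {K C : ℝ} (hu : DifferentiableOn ℂ u {z | 0 < z.im})
    (hC : 0 ≤ C) (hexp : ∀ z : ℂ, 1 ≤ z.im → ‖u z‖ ≤ K * Real.exp (C * z.im))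
    (hmt : meanType u ≤ 0) {z : ℂ} (hz : 1 ≤ z.im) : ‖u z‖ ≤ K * Real.exp C := by
  have hK : 0 ≤ K := nonneg_of_mul_nonneg_left
    ((norm_nonneg _).trans (hexp Complex.I (by simp))) (Real.exp_pos _)
  set A : ℂ → ℂ := fun ζ => Complex.I * ζ + Complex.I with hA
  have hAim (ζ : ℂ) : (A ζ).im = ζ.re + 1 := by simp [hA]
  have hbound {ζ : ℂ} (hζ : 0 ≤ ζ.re) : ‖(u ∘ A) ζ‖ ≤ K * Real.exp C * Real.exp (C * ζ.re) := by
    rw [mul_assoc, ← Real.exp_add, ← mul_one_add, add_comm 1, ← hAim]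
    exact hexp _ (by rw [hAim]; linarith)
  have hzA : A (z / Complex.I - 1) = z := by
    simp only [hA]
    field_simp
    ring
  rw [← hzA]
  refine norm_le_of_subexponential_on_real (f := u ∘ A) ?_ ⟨1, by norm_num, C, ?_⟩
    (fun ε hε => ?_) (fun x => ?_) (by simpa [Complex.div_I] using hz)
  · refine DifferentiableOn.diffContOnCl (hu.comp (Differentiable.differentiableOn (by fun_prop))
      fun ζ hζ => ?_)
    rw [Complex.closure_setOfPred_lt_re] at hζ
    have : 0 ≤ ζ.re := hζ
    rw [Set.mem_ofPred_eq, hAim]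
    linarith
  · refine Asymptotics.IsBigO.of_bound (K * Real.exp C) (eventually_inf_principal.2
      (Eventually.of_forall fun ζ (hζ : 0 < ζ.re) => (hbound hζ.le).trans ?_))
    rw [Real.norm_of_nonneg (Real.exp_nonneg _), Real.rpow_one]
    gcongr
    exact Complex.re_le_norm ζ
  · filter_upwards [(tendsto_atTop_add_const_right atTop (1 : ℝ) tendsto_id).eventually
      (meanType_nonpos_iff.1 hmt (ε / 2) (half_pos hε)), eventually_ge_atTop 1] with x hx hx1
    have hAx : A x = ((x + 1 : ℝ) : ℂ) * Complex.I := by simp only [hA]; push_cast; ring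
    rw [Function.comp_apply, hAx]
    refine hx.trans (Real.exp_le_exp.2 ?_)
    simp only [id]
    nlinarith
  · simpa using hbound (ζ := x * Complex.I) (by simp)

end MeanType

section Hardy

variable {u : ℂ → ℂ}

/-- Bounded type and nonpositive mean type in the upper half-plane, the condition that membership in
a de Branges space imposes on `f / E` and `f* / E`. For functions analytic across the real line it
describes the Smirnov class `N⁺`. -/
def IsTame (u : ℂ → ℂ) : Prop := IsBoundedType u ∧ meanType u ≤ 0

/-- The functions of the Hardy space `H^p` of the upper half-plane that extend analytically across
the real line. They are described by their boundary values: for a function in the class `IsTame`,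
integrability on the real line controls all horizontal lines. -/
structure IsHardy (p : ℝ≥0∞) (u : ℂ → ℂ) : Prop where
  analytic : AnalyticOnNhd ℂ u {z | 0 ≤ z.im}
  tame : IsTame u
  memLp : MemLp (fun t : ℝ => u t) p

theorem IsTame.norm_le_of_one_le_im {C : ℝ} (hu : IsTame u) (hint : Integrable fun t : ℝ => u t)
    (hC : 0 ≤ C) (hmaj : ∀ z : ℂ, 0 < z.im →
      ‖u z‖ ≤ Real.exp (1 + C * z.im) * poissonIntegral (fun t => ‖u t‖) z)
    {z : ℂ} (hz : 1 ≤ z.im) : ‖u z‖ ≤ Real.exp 1 * (∫ t : ℝ, ‖u t‖) * Real.exp C := by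
  refine norm_le_of_meanType_nonpos hu.1.1 hC (fun z hz => ?_) hu.2 hz
  have hz0 : 0 < z.im := one_pos.trans_le hz
  have hpoisson : poissonIntegral (fun t => ‖u t‖) z ≤ ∫ t : ℝ, ‖u t‖ :=
    (poissonIntegral_le hint.norm (fun t => norm_nonneg _) hz0).trans
      (div_le_self (integral_nonneg fun t => norm_nonneg _) (by nlinarith [Real.pi_gt_three]))
  calc ‖u z‖ ≤ Real.exp (1 + C * z.im) * ∫ t : ℝ, ‖u t‖ := (hmaj z hz0).trans (by gcongr)
    _ = Real.exp 1 * (∫ t : ℝ, ‖u t‖) * Real.exp (C * z.im) := by rw [Real.exp_add]; ring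

theorem lintegral_horizontal_le {C : ℝ} (hint : Integrable fun t : ℝ => u t)
    (hC : 0 ≤ C) (hmaj : ∀ z : ℂ, 0 < z.im →
      ‖u z‖ ≤ Real.exp (1 + C * z.im) * poissonIntegral (fun t => ‖u t‖) z)
    {y : ℝ} (hy : y ∈ Set.Ioc (0 : ℝ) 1) :
    ∫⁻ x : ℝ, ‖u (x + y * Complex.I)‖ₑ ≤
      ENNReal.ofReal (Real.exp (1 + C)) * ∫⁻ t : ℝ, ‖u t‖ₑ := by
  simp only [← ofReal_norm]
  rw [← lintegral_poissonIntegral hint.norm (fun t => norm_nonneg _) hy.1,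
    ← lintegral_const_mul' _ _ ENNReal.ofReal_ne_top]
  refine lintegral_mono fun x => ?_
  rw [← ENNReal.ofReal_mul (Real.exp_nonneg _)]
  have him : ((x : ℂ) + y * Complex.I).im = y := by simp
  refine ENNReal.ofReal_le_ofReal ((hmaj _ (by simpa using hy.1)).trans ?_)
  refine mul_le_mul_of_nonneg_right (Real.exp_le_exp.2 ?_)
    (poissonIntegral_nonneg (fun t => norm_nonneg _) (by simpa using hy.1.le))
  rw [him]
  nlinarith [hy.2]

theorem frequently_lt_of_lintegral_ne_top {f : ℝ → ℝ≥0∞} (hf : ∫⁻ x, f x ≠ ∞) {η : ℝ≥0∞}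
    (hη : 0 < η) : ∃ᶠ x in atTop, f x < η := by
  intro hge
  obtain ⟨X, hX⟩ := eventually_atTop.1 hge
  refine hf (top_le_iff.1 ?_)
  calc ∞ = ∫⁻ _ in Set.Ici X, η := by
        rw [setLIntegral_const, Real.volume_Ici, ENNReal.mul_top hη.ne']
    _ ≤ ∫⁻ x in Set.Ici X, f x :=
        setLIntegral_mono' measurableSet_Ici fun x hx => not_lt.1 (hX x hx)
    _ ≤ ∫⁻ x, f x := setLIntegral_le_lintegral _ _

theorem frequently_vertical_lt (hu : ContinuousOn u {z | 0 ≤ z.im}) {M : ℝ≥0∞} (hM : M ≠ ∞)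
    (hle : ∀ y ∈ Set.Ioc (0 : ℝ) 1, ∫⁻ x : ℝ, ‖u (x + y * Complex.I)‖ₑ ≤ M) {η : ℝ≥0∞}
    (hη : 0 < η) : ∃ᶠ R : ℝ in atTop,
      (∫⁻ y in Set.Ioc (0 : ℝ) 1, ‖u (R + y * Complex.I)‖ₑ) +
        (∫⁻ y in Set.Ioc (0 : ℝ) 1, ‖u ((-R : ℝ) + y * Complex.I)‖ₑ) < η := by
  set P : ℝ × ℝ → ℝ≥0∞ := fun q => ‖u (q.1 + ((max q.2 0 : ℝ) : ℂ) * Complex.I)‖ₑ with hP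
  have hPm : Measurable P :=
    (hu.comp_continuous (by fun_prop) fun q => by simp).enorm.measurable
  have hPeq {x y : ℝ} (hy : y ∈ Set.Ioc (0 : ℝ) 1) : ‖u (x + y * Complex.I)‖ₑ = P (x, y) := by
    simp only [hP, max_eq_left hy.1.le]
  have hvert (x : ℝ) : ∫⁻ y in Set.Ioc (0 : ℝ) 1, ‖u (x + y * Complex.I)‖ₑ =
      ∫⁻ y in Set.Ioc (0 : ℝ) 1, P (x, y) := setLIntegral_congr_fun measurableSet_Ioc fun y => hPeq
  have hfin : ∫⁻ x, ∫⁻ y in Set.Ioc (0 : ℝ) 1, P (x, y) ≠ ∞ := by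
    rw [lintegral_lintegral_swap hPm.aemeasurable]
    refine ne_top_of_le_ne_top hM ?_
    calc ∫⁻ y in Set.Ioc (0 : ℝ) 1, ∫⁻ x, P (x, y) ≤ ∫⁻ _ in Set.Ioc (0 : ℝ) 1, M :=
          setLIntegral_mono' measurableSet_Ioc fun _ hy => by simpa only [hPeq hy] using hle _ hy
      _ = M := by simp
  simp only [hvert]
  refine frequently_lt_of_lintegral_ne_top ?_ hη
  rw [lintegral_add_left hPm.lintegral_prod_right', lintegral_neg_eq_self
    (fun x => ∫⁻ y in Set.Ioc (0 : ℝ) 1, P (x, y))]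
  exact ENNReal.add_ne_top.2 ⟨hfin, hfin⟩

section Contour

variable {q : ℂ → ℂ} {D R : ℝ}

theorem norm_le_div_sq (hR : 1 ≤ R) (hD : ∀ z : ℂ, 1 ≤ z.im → ‖q z‖ ≤ D / ‖z‖ ^ 2) {z : ℂ}
    (hz : 1 ≤ z.im) (hRz : R ≤ ‖z‖) : ‖q z‖ ≤ D / R ^ 2 := by
  have hD0 : 0 ≤ D := by simpa using (norm_nonneg _).trans (hD Complex.I (by simp))
  exact (hD z hz).trans (by gcongr)

theorem norm_integral_top_le (hR : 1 ≤ R) (hD : ∀ z : ℂ, 1 ≤ z.im → ‖q z‖ ≤ D / ‖z‖ ^ 2) :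
    ‖∫ x in (-R)..R, q (x + R * Complex.I)‖ ≤ 2 * (D / R) := by
  have hR0 : 0 < R := one_pos.trans_le hR
  refine (intervalIntegral.norm_integral_le_of_norm_le_const (C := D / R ^ 2) fun x _ =>
    norm_le_div_sq hR hD (by simpa using hR) ?_).trans_eq ?_
  · simpa [abs_of_pos hR0] using Complex.abs_im_le_norm ((x : ℂ) + R * Complex.I)
  · rw [sub_neg_eq_add, abs_of_pos (by positivity)]
    field_simp
    ring

theorem norm_integral_side_le (hq : ContinuousOn q {z | 0 ≤ z.im}) (hR : 1 ≤ R)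
    (hD : ∀ z : ℂ, 1 ≤ z.im → ‖q z‖ ≤ D / ‖z‖ ^ 2) {a : ℝ} (ha : |a| = R) :
    ‖∫ y in (0 : ℝ)..R, q (a + y * Complex.I)‖ ≤
      ‖∫ y in (0 : ℝ)..1, q (a + y * Complex.I)‖ + D / R := by
  have hR0 : 0 < R := one_pos.trans_le hR
  have hD0 : 0 ≤ D := by simpa using (norm_nonneg _).trans (hD Complex.I (by simp))
  have hcont : ContinuousOn (fun y : ℝ => q (a + y * Complex.I)) (Set.Ici 0) :=
    hq.comp (by fun_prop) fun y hy => by simpa using hy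
  have hint {b c : ℝ} (hb : 0 ≤ b) (hc : 0 ≤ c) :
      IntervalIntegrable (fun y : ℝ => q (a + y * Complex.I)) volume b c :=
    (hcont.mono fun y hy => (le_min hb hc).trans hy.1).intervalIntegrable
  rw [← intervalIntegral.integral_add_adjacent_intervals (hint le_rfl zero_le_one)
    (hint zero_le_one hR0.le)]
  refine (norm_add_le _ _).trans (add_le_add_right ?_ _)
  refine (intervalIntegral.norm_integral_le_of_norm_le_const (C := D / R ^ 2) fun y hy =>
    norm_le_div_sq hR hD ?_ ?_).trans ?_
  · rw [Set.uIoc_of_le hR] at hy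
    simpa using hy.1.le
  · simpa [ha] using Complex.abs_re_le_norm ((a : ℂ) + y * Complex.I)
  · rw [abs_of_nonneg (by linarith)]
    calc D / R ^ 2 * (R - 1) ≤ D / R ^ 2 * R := by gcongr; linarith
      _ = D / R := by field_simp

theorem norm_integral_le_of_rect (hq : DifferentiableOn ℂ q {z | 0 ≤ z.im}) (hR : 1 ≤ R)
    (hD : ∀ z : ℂ, 1 ≤ z.im → ‖q z‖ ≤ D / ‖z‖ ^ 2) :
    ‖∫ x in (-R)..R, q x‖ ≤ ‖∫ y in (0 : ℝ)..1, q (R + y * Complex.I)‖ +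
      ‖∫ y in (0 : ℝ)..1, q ((-R : ℝ) + y * Complex.I)‖ + 4 * (D / R) := by
  have hR0 : 0 < R := one_pos.trans_le hR
  have hrect := Complex.integral_boundary_rect_eq_zero_of_differentiableOn q ((-R : ℝ) : ℂ)
    (R + R * Complex.I) (hq.mono fun z hz => by
      have him : z.im ∈ Set.uIcc 0 R := by simpa using hz.2
      rw [Set.uIcc_of_le hR0.le] at him
      exact him.1)
  simp only [Complex.ofReal_re, Complex.ofReal_im, Complex.add_re, Complex.mul_re, Complex.I_re,
    Complex.I_im, Complex.add_im, Complex.mul_im, mul_zero, mul_one, zero_mul, sub_zero, add_zero,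
    zero_add, Complex.ofReal_zero, smul_eq_mul] at hrect
  have hsum : ∫ x in (-R)..R, q x = (∫ x in (-R)..R, q (x + R * Complex.I)) -
      Complex.I * (∫ y in (0 : ℝ)..R, q (R + y * Complex.I)) +
      Complex.I * ∫ y in (0 : ℝ)..R, q ((-R : ℝ) + y * Complex.I) := by
    linear_combination hrect
  have htop := norm_integral_top_le hR hD
  have hright := norm_integral_side_le hq.continuousOn hR hD (abs_of_pos hR0)
  have hleft := norm_integral_side_le hq.continuousOn hR hD
    (a := -R) (by rw [abs_neg, abs_of_pos hR0])
  rw [hsum]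
  refine (norm_add_le _ _).trans ((add_le_add_left (norm_sub_le _ _) _).trans ?_)
  simp only [norm_mul, Complex.norm_I, one_mul]
  linarith

end Contour

theorem integral_eq_zero_of_norm_le_div_sq {q : ℂ → ℂ} {D : ℝ} {M : ℝ≥0∞}
    (hq : DifferentiableOn ℂ q {z | 0 ≤ z.im}) (hint : Integrable fun t : ℝ => q t)
    (hD : ∀ z : ℂ, 1 ≤ z.im → ‖q z‖ ≤ D / ‖z‖ ^ 2) (hM : M ≠ ∞)
    (hle : ∀ y ∈ Set.Ioc (0 : ℝ) 1, ∫⁻ x : ℝ, ‖q (x + y * Complex.I)‖ₑ ≤ M) :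
    ∫ t : ℝ, q t = 0 := by
  have hlim : Tendsto (fun R : ℝ => ‖∫ x in (-R)..R, q x‖) atTop (𝓝 ‖∫ t : ℝ, q t‖) :=
    (intervalIntegral_tendsto_integral hint tendsto_neg_atTop_atBot tendsto_id).norm
  have hside (a : ℝ) : ENNReal.ofReal ‖∫ y in (0 : ℝ)..1, q (a + y * Complex.I)‖ ≤
      ∫⁻ y in Set.Ioc (0 : ℝ) 1, ‖q (a + y * Complex.I)‖ₑ := by
    rw [intervalIntegral.integral_of_le zero_le_one, ofReal_norm]
    exact enorm_integral_le_lintegral_enorm _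
  refine norm_le_zero_iff.1 (le_of_forall_pos_le_add fun η hη => ?_)
  have hbound : Tendsto (fun R : ℝ => η + 4 * (D / R)) atTop (𝓝 (η + 4 * 0)) :=
    tendsto_const_nhds.add ((tendsto_const_nhds.div_atTop tendsto_id).const_mul 4)
  refine (le_of_tendsto_of_tendsto_of_frequently hlim hbound ?_).trans_eq (by ring)
  refine ((frequently_vertical_lt hq.continuousOn hM hle (ENNReal.ofReal_pos.2 hη)).and_eventually
    (eventually_ge_atTop 1)).mono fun R ⟨hlt, hR⟩ => ?_
  have hsides := (add_le_add (hside R) (hside (-R))).trans hlt.le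
  rw [← ENNReal.ofReal_add (norm_nonneg _) (norm_nonneg _),
    ENNReal.ofReal_le_ofReal_iff hη.le] at hsides
  exact (norm_integral_le_of_rect hq hR hD).trans (by gcongr)

theorem one_le_norm_I_add_mul {ε : ℝ} {z : ℂ} (hε : 0 ≤ ε) (hz : 0 ≤ z.im) :
    1 ≤ ‖Complex.I + ε * z‖ := by
  have him : (Complex.I + ε * z).im = 1 + ε * z.im := by simp
  have : 1 ≤ (Complex.I + ε * z).im := by rw [him]; linarith [mul_nonneg hε hz]
  exact this.trans (Complex.im_le_norm _)

theorem mul_norm_le_norm_I_add_mul {ε : ℝ} {z : ℂ} (hε : 0 ≤ ε) (hz : 0 ≤ z.im) :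
    ε * ‖z‖ ≤ ‖Complex.I + ε * z‖ := by
  have hmul : ε * ‖z‖ = ‖(ε : ℂ) * z‖ := by rw [norm_mul, Complex.norm_of_nonneg hε]
  rw [hmul, Complex.norm_def, Complex.norm_def]
  refine Real.sqrt_le_sqrt ?_
  simp only [Complex.normSq_apply, Complex.add_re, Complex.add_im, Complex.re_ofReal_mul,
    Complex.im_ofReal_mul, Complex.I_re, Complex.I_im]
  nlinarith [mul_nonneg hε hz]

/-- The function `(i / (i + ε z)) ^ 2 u(z)`, which decays quadratically where `u` is bounded and
tends to `u` as `ε → 0`. -/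
noncomputable def damp (ε : ℝ) (u : ℂ → ℂ) (z : ℂ) : ℂ :=
  (Complex.I / (Complex.I + ε * z)) ^ 2 * u z

theorem norm_damp (ε : ℝ) (z : ℂ) : ‖damp ε u z‖ = ‖u z‖ / ‖Complex.I + ε * z‖ ^ 2 := by
  simp only [damp, norm_mul, norm_pow, norm_div, Complex.norm_I]
  ring

theorem norm_damp_le {ε : ℝ} {z : ℂ} (hε : 0 ≤ ε) (hz : 0 ≤ z.im) : ‖damp ε u z‖ ≤ ‖u z‖ := by
  rw [norm_damp]
  exact div_le_self (norm_nonneg _) (one_le_pow₀ (one_le_norm_I_add_mul hε hz))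

theorem norm_damp_le_div_sq {ε B : ℝ} {z : ℂ} (hε : 0 < ε) (hz : 0 < z.im) (hB : ‖u z‖ ≤ B) :
    ‖damp ε u z‖ ≤ B / ε ^ 2 / ‖z‖ ^ 2 := by
  have hz0 : 0 < ‖z‖ := norm_pos_iff.2 fun h => hz.ne' (by simp [h])
  have hB0 : 0 ≤ B := (norm_nonneg _).trans hB
  rw [norm_damp, div_div, ← mul_pow]
  gcongr
  exact mul_norm_le_norm_I_add_mul hε.le hz.le

theorem differentiableOn_damp {ε : ℝ} (hε : 0 ≤ ε) (hu : DifferentiableOn ℂ u {z | 0 ≤ z.im}) :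
    DifferentiableOn ℂ (damp ε u) {z | 0 ≤ z.im} := by
  refine DifferentiableOn.mul (DifferentiableOn.pow (DifferentiableOn.div (by fun_prop)
    (by fun_prop) fun z hz => ?_) 2) hu
  exact norm_pos_iff.1 (one_pos.trans_le (one_le_norm_I_add_mul hε hz))

theorem tendsto_damp (z : ℂ) : Tendsto (fun ε : ℝ => damp ε u z) (𝓝 0) (𝓝 (u z)) := by
  have hfactor : ContinuousAt (fun ε : ℝ => Complex.I / (Complex.I + ε * z)) 0 :=
    ContinuousAt.div (by fun_prop) (by fun_prop) (by simp)
  simpa [damp] using ((hfactor.pow 2).mul_const (u z)).tendsto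

theorem aestronglyMeasurable_ofReal (hu : ContinuousOn u {z | 0 ≤ z.im}) :
    AEStronglyMeasurable fun t : ℝ => u t :=
  (hu.comp_continuous Complex.continuous_ofReal fun _ => by simp).aestronglyMeasurable

theorem IsHardy.integral_eq_zero (hu : IsHardy 1 u) : ∫ t : ℝ, u t = 0 := by
  have hint : Integrable fun t : ℝ => u t := memLp_one_iff_integrable.1 hu.memLp
  have hdiff := hu.analytic.differentiableOn
  obtain ⟨C, hC, hmaj⟩ := hu.tame.1.exists_norm_le_exp_mul_poissonIntegral hu.analytic hint
  have hmeas {ε : ℝ} (hε : 0 ≤ ε) : AEStronglyMeasurable fun t : ℝ => damp ε u t :=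
    aestronglyMeasurable_ofReal (differentiableOn_damp hε hdiff).continuousOn
  have hdamp {ε : ℝ} (hε : 0 < ε) : ∫ t : ℝ, damp ε u t = 0 := by
    refine integral_eq_zero_of_norm_le_div_sq
      (M := ENNReal.ofReal (Real.exp (1 + C)) * ∫⁻ t : ℝ, ‖u t‖ₑ)
      (differentiableOn_damp hε.le hdiff)
      (hint.mono (hmeas hε.le) (ae_of_all _ fun t => norm_damp_le hε.le (by simp)))
      (fun z hz => norm_damp_le_div_sq hε (one_pos.trans_le hz)
        (hu.tame.norm_le_of_one_le_im hint hC hmaj hz))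
      (ENNReal.mul_ne_top ENNReal.ofReal_ne_top hint.2.ne) fun y hy => ?_
    exact (lintegral_mono fun x => enorm_le_iff_norm_le.2
      (norm_damp_le hε.le (by simpa using hy.1.le))).trans (lintegral_horizontal_le hint hC hmaj hy)
  have hlim : Tendsto (fun ε : ℝ => ∫ t : ℝ, damp ε u t) (𝓝[>] 0) (𝓝 (∫ t : ℝ, u t)) :=
    tendsto_integral_filter_of_dominated_convergence (fun t => ‖u t‖)
      (eventually_nhdsWithin_of_forall fun ε hε => hmeas (le_of_lt hε))
      (eventually_nhdsWithin_of_forall fun ε hε =>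
        ae_of_all _ fun t => norm_damp_le (le_of_lt hε) (by simp)) hint.norm
      (ae_of_all _ fun t => (tendsto_damp t).mono_left nhdsWithin_le_nhds)
  exact tendsto_nhds_unique hlim (tendsto_const_nhds.congr'
    (eventually_nhdsWithin_of_forall fun ε hε => (hdamp hε).symm))

end Hardy

section Tame

variable {f g : ℂ → ℂ}

theorem isOpen_im_pos : IsOpen {z : ℂ | 0 < z.im} :=
  isOpen_lt continuous_const Complex.continuous_im

theorem exists_mul_ne_zero (hf : DifferentiableOn ℂ f {z | 0 < z.im})
    (hg : DifferentiableOn ℂ g {z | 0 < z.im}) (hf0 : ∃ z : ℂ, 0 < z.im ∧ f z ≠ 0)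
    (hg0 : ∃ z : ℂ, 0 < z.im ∧ g z ≠ 0) : ∃ z : ℂ, 0 < z.im ∧ f z * g z ≠ 0 := by
  obtain ⟨a, ha, hfa⟩ := hf0
  obtain ⟨b, hb, hgb⟩ := hg0
  by_contra! hfg
  exact (AnalyticOnNhd.eq_zero_or_eq_zero_of_mul_eq_zero (hf.analyticOnNhd isOpen_im_pos)
    (hg.analyticOnNhd isOpen_im_pos) hfg (convex_halfSpace_im_gt 0).isPreconnected).elim
    (fun h => hfa (h a ha)) (fun h => hgb (h b hb))

theorem norm_mul_le_mul {a b : ℂ} {M N : ℝ} (ha : ‖a‖ ≤ M) (hb : ‖b‖ ≤ N) : ‖a * b‖ ≤ M * N :=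
  (norm_mul_le a b).trans (mul_le_mul ha hb (norm_nonneg _) ((norm_nonneg _).trans ha))

namespace IsBoundedType

theorem congr (hf : IsBoundedType f) (hfg : ∀ z : ℂ, 0 < z.im → g z = f z) : IsBoundedType g := by
  obtain ⟨hd, P, Q, hP, hQ, hM, hQ0, hfQ⟩ := hf
  exact ⟨hd.congr hfg, P, Q, hP, hQ, hM, hQ0, fun z hz => by rw [hfg z hz, hfQ z hz]⟩

theorem add (hf : IsBoundedType f) (hg : IsBoundedType g) : IsBoundedType fun z => f z + g z := by
  obtain ⟨hfd, P₁, Q₁, hP₁, hQ₁, ⟨M₁, hM₁⟩, hQ₁0, hf⟩ := hf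
  obtain ⟨hgd, P₂, Q₂, hP₂, hQ₂, ⟨M₂, hM₂⟩, hQ₂0, hg⟩ := hg
  refine ⟨hfd.add hgd, fun z => P₁ z * Q₂ z + Q₁ z * P₂ z, fun z => Q₁ z * Q₂ z,
    (hP₁.mul hQ₂).add (hQ₁.mul hP₂), hQ₁.mul hQ₂, ⟨M₁ * M₂ + M₁ * M₂, fun z hz => ?_⟩,
    exists_mul_ne_zero hQ₁ hQ₂ hQ₁0 hQ₂0, fun z hz => ?_⟩
  · obtain ⟨hP₁M, hQ₁M⟩ := hM₁ z hz
    obtain ⟨hP₂M, hQ₂M⟩ := hM₂ z hz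
    have hQM := norm_mul_le_mul hQ₁M hQ₂M
    exact ⟨norm_add_le_of_le (norm_mul_le_mul hP₁M hQ₂M) (norm_mul_le_mul hQ₁M hP₂M),
      hQM.trans (le_add_of_nonneg_left ((norm_nonneg _).trans hQM))⟩
  · simp only [← hf z hz, ← hg z hz]
    ring

theorem mul (hf : IsBoundedType f) (hg : IsBoundedType g) : IsBoundedType fun z => f z * g z := by
  obtain ⟨hfd, P₁, Q₁, hP₁, hQ₁, ⟨M₁, hM₁⟩, hQ₁0, hf⟩ := hf
  obtain ⟨hgd, P₂, Q₂, hP₂, hQ₂, ⟨M₂, hM₂⟩, hQ₂0, hg⟩ := hg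
  refine ⟨hfd.mul hgd, fun z => P₁ z * P₂ z, fun z => Q₁ z * Q₂ z, hP₁.mul hP₂, hQ₁.mul hQ₂,
    ⟨M₁ * M₂, fun z hz => ?_⟩, exists_mul_ne_zero hQ₁ hQ₂ hQ₁0 hQ₂0, fun z hz => ?_⟩
  · exact ⟨norm_mul_le_mul (hM₁ z hz).1 (hM₂ z hz).1, norm_mul_le_mul (hM₁ z hz).2 (hM₂ z hz).2⟩
  · simp only [← hf z hz, ← hg z hz]
    ring

theorem of_mul_left (hf : IsBoundedType f) (hf0 : ∃ z : ℂ, 0 < z.im ∧ f z ≠ 0)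
    (hgd : DifferentiableOn ℂ g {z | 0 < z.im}) (hfg : IsBoundedType fun z => f z * g z) :
    IsBoundedType g := by
  obtain ⟨hfd, P₁, Q₁, hP₁, hQ₁, ⟨M₁, hM₁⟩, hQ₁0, hf⟩ := hf
  obtain ⟨-, P₂, Q₂, hP₂, hQ₂, ⟨M₂, hM₂⟩, hQ₂0, hfg⟩ := hfg
  have hP₁0 : ∃ z : ℂ, 0 < z.im ∧ P₁ z ≠ 0 := by
    obtain ⟨z, hz, hne⟩ := exists_mul_ne_zero hfd hQ₁ hf0 hQ₁0
    exact ⟨z, hz, hf z hz ▸ hne⟩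
  refine ⟨hgd, fun z => Q₁ z * P₂ z, fun z => P₁ z * Q₂ z, hQ₁.mul hP₂, hP₁.mul hQ₂,
    ⟨M₁ * M₂, fun z hz => ?_⟩, exists_mul_ne_zero hP₁ hQ₂ hP₁0 hQ₂0, fun z hz => ?_⟩
  · exact ⟨norm_mul_le_mul (hM₁ z hz).2 (hM₂ z hz).1, norm_mul_le_mul (hM₁ z hz).1 (hM₂ z hz).2⟩
  · simp only [← hf z hz, ← hfg z hz]
    ring

end IsBoundedType

theorem add_I_ne_zero {z : ℂ} (hz : 0 ≤ z.im) : z + Complex.I ≠ 0 := by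
  simpa using sub_conj_ne_zero (z₀ := Complex.I) (by simp) hz

theorem one_le_norm_add_I {z : ℂ} (hz : 0 ≤ z.im) : 1 ≤ ‖z + Complex.I‖ := by
  simpa [add_comm] using one_le_norm_I_add_mul zero_le_one hz

theorem isBoundedType_sub_const (a : ℂ) : IsBoundedType fun z => z - a := by
  have hne : ∀ z ∈ {z : ℂ | 0 < z.im}, z + Complex.I ≠ 0 := fun z hz => add_I_ne_zero (le_of_lt hz)
  refine ⟨by fun_prop, fun z => (z - a) / (z + Complex.I), fun z => 1 / (z + Complex.I),
    DifferentiableOn.div (by fun_prop) (by fun_prop) hne,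
    DifferentiableOn.div (by fun_prop) (by fun_prop) hne,
    ⟨1 + ‖a + Complex.I‖, fun z hz => ?_⟩,
    ⟨Complex.I, by simp, one_div_ne_zero (hne _ (by simp))⟩, fun z _ => by ring⟩
  have hone := one_le_norm_add_I hz.le
  simp only [norm_div, norm_one]
  rw [div_le_iff₀ (one_pos.trans_le hone), div_le_iff₀ (one_pos.trans_le hone)]
  refine ⟨?_, by nlinarith [norm_nonneg (a + Complex.I)]⟩
  calc ‖z - a‖ = ‖z + Complex.I - (a + Complex.I)‖ := by ring_nf
    _ ≤ ‖z + Complex.I‖ + ‖a + Complex.I‖ := norm_sub_le _ _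
    _ ≤ (1 + ‖a + Complex.I‖) * ‖z + Complex.I‖ := by
      nlinarith [norm_nonneg (a + Complex.I)]

namespace IsTame

theorem congr (hf : IsTame f) (hfg : ∀ z : ℂ, 0 < z.im → g z = f z) : IsTame g := by
  refine ⟨hf.1.congr hfg, meanType_nonpos_iff.2 fun ε hε => ?_⟩
  filter_upwards [meanType_nonpos_iff.1 hf.2 ε hε, eventually_gt_atTop 0] with y hy hy0
  rwa [hfg _ (by simpa using hy0)]

theorem mul (hf : IsTame f) (hg : IsTame g) : IsTame fun z => f z * g z := by
  refine ⟨hf.1.mul hg.1, meanType_nonpos_iff.2 fun ε hε => ?_⟩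
  filter_upwards [meanType_nonpos_iff.1 hf.2 (ε / 2) (half_pos hε),
    meanType_nonpos_iff.1 hg.2 (ε / 2) (half_pos hε)] with y hfy hgy
  calc _ ≤ Real.exp (ε / 2 * y) * Real.exp (ε / 2 * y) := norm_mul_le_mul hfy hgy
    _ = Real.exp (ε * y) := by rw [← Real.exp_add]; ring_nf

theorem add (hf : IsTame f) (hg : IsTame g) : IsTame fun z => f z + g z := by
  refine ⟨hf.1.add hg.1, meanType_nonpos_iff.2 fun ε hε => ?_⟩
  have hexp : Tendsto (fun y : ℝ => Real.exp (ε / 2 * y)) atTop atTop :=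
    Real.tendsto_exp_atTop.comp (tendsto_id.const_mul_atTop (half_pos hε))
  filter_upwards [meanType_nonpos_iff.1 hf.2 (ε / 2) (half_pos hε),
    meanType_nonpos_iff.1 hg.2 (ε / 2) (half_pos hε), hexp.eventually_ge_atTop 2] with y hfy hgy hy
  calc _ ≤ Real.exp (ε / 2 * y) + Real.exp (ε / 2 * y) := norm_add_le_of_le hfy hgy
    _ ≤ Real.exp (ε / 2 * y) * Real.exp (ε / 2 * y) := by nlinarith
    _ = Real.exp (ε * y) := by rw [← Real.exp_add]; ring_nf

theorem of_norm_le (hf : DifferentiableOn ℂ f {z | 0 < z.im}) {M : ℝ}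
    (hM : ∀ z : ℂ, 0 < z.im → ‖f z‖ ≤ M) : IsTame f := by
  refine ⟨⟨hf, f, fun _ => 1, hf, differentiableOn_const _, ⟨max M 1, fun z hz =>
    ⟨(hM z hz).trans (le_max_left _ _), by simp⟩⟩, ⟨Complex.I, by simp, one_ne_zero⟩,
    fun z _ => mul_one _⟩, meanType_nonpos_iff.2 fun ε hε => ?_⟩
  have hexp : Tendsto (fun y : ℝ => Real.exp (ε * y)) atTop atTop :=
    Real.tendsto_exp_atTop.comp (tendsto_id.const_mul_atTop hε)
  filter_upwards [hexp.eventually_ge_atTop M, eventually_gt_atTop 0] with y hMy hy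
  exact (hM _ (by simpa using hy)).trans hMy

theorem of_sub_mul {a : ℂ} (hf : DifferentiableOn ℂ f {z | 0 < z.im})
    (haf : IsTame fun z => (z - a) * f z) : IsTame f := by
  refine ⟨(isBoundedType_sub_const a).of_mul_left ⟨a + (1 + |a.im| : ℝ) * Complex.I, ?_, ?_⟩ hf
    haf.1, meanType_nonpos_iff.2 fun ε hε => ?_⟩
  · simp only [Complex.add_im, Complex.im_ofReal_mul, Complex.I_im]
    linarith [neg_abs_le a.im]
  · rw [add_sub_cancel_left]
    exact mul_ne_zero (by exact_mod_cast (by positivity : 1 + |a.im| ≠ 0)) Complex.I_ne_zero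
  · filter_upwards [meanType_nonpos_iff.1 haf.2 ε hε, eventually_ge_atTop (1 + a.im)] with y hfy hy
    have hone : 1 ≤ ‖(y : ℂ) * Complex.I - a‖ := by
      have him : ((y : ℂ) * Complex.I - a).im = y - a.im := by simp
      exact (by linarith : 1 ≤ y - a.im).trans (him ▸ Complex.im_le_norm _)
    rw [norm_mul] at hfy
    exact (le_mul_of_one_le_left (norm_nonneg _) hone).trans hfy

end IsTame

end Tame

section HermiteBiehler

variable {E f : ℂ → ℂ}

theorem entireStar_entireStar (f : ℂ → ℂ) : entireStar (entireStar f) = f := by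
  ext z
  simp [entireStar]

theorem entireStar_ofReal (f : ℂ → ℂ) (t : ℝ) : entireStar f t = conj (f t) := by
  simp [entireStar]

theorem differentiable_entireStar (hf : Differentiable ℂ f) : Differentiable ℂ (entireStar f) :=
  fun z => by simpa [Function.comp_def] using! (hf (conj z)).conj_conj

theorem meromorphicOrderAt_nonneg_of_intervalIntegrable {g : ℂ → ℂ} {l : ℝ}
    (hg : MeromorphicAt g l)
    (hint : IntervalIntegrable (fun t : ℝ => g t) volume (l - 1) (l + 1)) :
    0 ≤ meromorphicOrderAt g l := by
  by_contra! hneg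
  obtain ⟨n, hn⟩ := WithTop.ne_top_iff_exists.1 (hneg.trans_le le_top).ne
  have hpole : 0 ≤ meromorphicOrderAt (fun z : ℂ => (z - l)⁻¹ / g z) (l : ℂ) := by
    rw [fun_meromorphicOrderAt_div (by fun_prop) hg, fun_meromorphicOrderAt_inv,
      meromorphicOrderAt_id_sub_const, ← hn]
    rw [← hn] at hneg
    norm_cast at hneg
    exact WithTop.coe_le_coe.2 (show (0 : ℤ) ≤ -1 - n by omega)
  obtain ⟨c, hc⟩ := tendsto_nhds_of_meromorphicOrderAt_nonneg (by fun_prop) hpole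
  have hcoe : Tendsto (fun t : ℝ => (t : ℂ)) (𝓝[≠] l) (𝓝[≠] (l : ℂ)) :=
    Complex.continuous_ofReal.continuousAt.continuousWithinAt.tendsto_nhdsWithin
      fun t ht => by simpa using ht
  have hbigO : (fun z : ℂ => (z - l)⁻¹) =O[𝓝[≠] (l : ℂ)] g :=
    Asymptotics.isBigO_of_div_tendsto_nhds (((meromorphicOrderAt_ne_top_iff_eventually_ne_zero
      hg).1 (hneg.trans_le le_top).ne).mono fun z hz h => absurd h hz) c hc
  refine not_intervalIntegrable_of_sub_inv_isBigO_punctured (c := l)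
    (((hbigO.comp_tendsto hcoe).norm_left).congr_left fun t => ?_).of_norm_left (by linarith) ?_
    hint
  · rw [Function.comp_apply, ← Complex.ofReal_sub, ← Complex.ofReal_inv, Complex.norm_real]
  · rw [Set.uIcc_of_le (by linarith)]
    constructor <;> linarith

namespace IsHermiteBiehler

theorem ne_zero (hE : IsHermiteBiehler E) {z : ℂ} (hz : 0 < z.im) : E z ≠ 0 :=
  norm_pos_iff.1 ((norm_nonneg _).trans_lt (hE.norm_conj_lt z hz))

theorem analyticOnNhd (hE : IsHermiteBiehler E) : AnalyticOnNhd ℂ E Set.univ :=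
  hE.entire.differentiableOn.analyticOnNhd isOpen_univ

theorem ae_ne_zero (hE : IsHermiteBiehler E) : ∀ᵐ t : ℝ, E t ≠ 0 := by
  have hzeros : {t : ℝ | E t = 0}.Countable :=
    Set.Countable.mono (fun t ht => Set.mem_sep (Set.mem_univ _) ht)
      ((countable_zeros_of_analyticOnNhd hE.analyticOnNhd isPreconnected_univ
        (Set.mem_univ Complex.I) (hE.ne_zero (by simp))).preimage Complex.ofReal_injective)
  simpa [ae_iff] using hzeros.measure_zero volume

theorem eventually_ne_zero (hE : IsHermiteBiehler E) (z : ℂ) : ∀ᶠ w in 𝓝[≠] z, E w ≠ 0 :=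
  (hE.analyticOnNhd z (Set.mem_univ z)).eventually_eq_zero_or_eventually_ne_zero.resolve_left
    fun h => hE.ne_zero (z := Complex.I) (by simp)
      (hE.analyticOnNhd.eqOn_zero_of_preconnected_of_eventuallyEq_zero isPreconnected_univ
        (Set.mem_univ z) h (Set.mem_univ Complex.I))

theorem mul {F : ℂ → ℂ} (hE : IsHermiteBiehler E) (hF : IsHermiteBiehler F) :
    IsHermiteBiehler (E * F) := by
  refine ⟨hE.entire.mul hF.entire, fun z hz => ?_⟩
  simp only [Pi.mul_apply, norm_mul]
  exact mul_lt_mul'' (hE.norm_conj_lt z hz) (hF.norm_conj_lt z hz) (norm_nonneg _) (norm_nonneg _)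

theorem exists_analytic_quotient (hE : IsHermiteBiehler E) (hf : Differentiable ℂ f)
    (hloc : LocallyIntegrable fun t : ℝ => f t / E t) :
    ∃ u : ℂ → ℂ, AnalyticOnNhd ℂ u {z | 0 ≤ z.im} ∧ ∀ z : ℂ, 0 ≤ z.im → u z * E z = f z := by
  set g : ℂ → ℂ := fun z => f z / E z with hg
  have hfa : AnalyticOnNhd ℂ f Set.univ := hf.differentiableOn.analyticOnNhd isOpen_univ
  have hgm : MeromorphicOn g Set.univ := fun z hz =>
    (hfa z hz).meromorphicAt.div (hE.analyticOnNhd z hz).meromorphicAt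
  set u := toMeromorphicNFOn g Set.univ with hu
  have hua : AnalyticOnNhd ℂ u {z | 0 ≤ z.im} := by
    intro z hz
    rw [← (meromorphicNFOn_toMeromorphicNFOn g Set.univ
      (Set.mem_univ z)).meromorphicOrderAt_nonneg_iff_analyticAt,
      meromorphicOrderAt_toMeromorphicNFOn hgm (Set.mem_univ z)]
    rcases eq_or_lt_of_le (show 0 ≤ z.im from hz) with hreal | hpos
    · obtain ⟨t, rfl⟩ : ∃ t : ℝ, z = t := ⟨z.re, Complex.ext rfl hreal.symm⟩
      exact meromorphicOrderAt_nonneg_of_intervalIntegrable (hgm _ (Set.mem_univ _))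
        (hloc.integrableOn_isCompact isCompact_uIcc).intervalIntegrable
    · exact ((hfa z (Set.mem_univ z)).div (hE.analyticOnNhd z (Set.mem_univ z))
        (hE.ne_zero hpos)).meromorphicOrderAt_nonneg
  refine ⟨u, hua, fun z hz => ?_⟩
  have hpunctured : (fun w => u w * E w) =ᶠ[𝓝[≠] z] f := by
    filter_upwards [hgm.toMeromorphicNFOn_eq_self_on_nhdsNE (Set.mem_univ z),
      hE.eventually_ne_zero z] with w hw hw'
    rw [hu, hw, hg]
    exact div_mul_cancel₀ _ hw'
  have hcont : ContinuousAt (fun w => u w * E w) z :=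
    (hua z hz).continuousAt.mul hE.entire.continuous.continuousAt
  exact ((hcont.eventuallyEq_nhds_iff_eventuallyEq_nhdsNE
    hf.continuous.continuousAt).1 hpunctured).eq_of_nhds

end IsHermiteBiehler

end HermiteBiehler

section HardyDivision

theorem memLp_inv_sub_add_I (a : ℝ) : MemLp (fun t : ℝ => ((t : ℂ) - (a + Complex.I))⁻¹) 2 := by
  have hne (t : ℝ) : (t : ℂ) - (a + Complex.I) ≠ 0 := ofReal_sub_ne_zero (by simp) t
  refine (memLp_two_iff_integrable_sq_norm (Continuous.aestronglyMeasurable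
    (Continuous.inv₀ (by fun_prop) hne))).2
    ((integrable_inv_one_add_sq.comp_sub_right a).congr (ae_of_all _ fun t => ?_))
  have hre : (t : ℂ) - (a + Complex.I) = (t - a : ℝ) + (-1 : ℝ) * Complex.I := by
    push_cast
    ring
  simp only [Pi.inv_apply, norm_inv, inv_pow]
  rw [hre, ← Complex.normSq_eq_norm_sq, Complex.normSq_add_mul_I]
  ring

theorem memLp_of_sub_mul {r s : ℝ≥0∞} [ENNReal.HolderTriple 2 r s] {p : ℝ → ℂ} (hp : Continuous p)
    {w : ℂ} (hwp : MemLp (fun t : ℝ => ((t : ℂ) - w) * p t) r) : MemLp p s := by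
  set z : ℂ := w.re + Complex.I with hz
  set S : Set ℝ := Set.Icc (w.re - 1) (w.re + 1)
  have hne (t : ℝ) : (t : ℂ) - z ≠ 0 := ofReal_sub_ne_zero (by simp [hz]) t
  have hcont : Continuous fun t : ℝ => ((t : ℂ) - z) * p t := by fun_prop
  obtain ⟨K, hK⟩ := isCompact_Icc.exists_bound_of_continuousOn (s := S) hcont.continuousOn
  have hnear : MemLp (S.indicator fun _ => K) r :=
    memLp_indicator_const r measurableSet_Icc K (Or.inr measure_Icc_lt_top.ne)
  have hzp : MemLp (fun t : ℝ => ((t : ℂ) - z) * p t) r := by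
    refine ((hwp.norm.const_mul 2).add hnear).of_le hcont.aestronglyMeasurable
      (ae_of_all _ fun t => ?_)
    refine le_trans ?_ (le_abs_self _)
    by_cases ht : t ∈ S
    · simp only [Pi.add_apply, Set.indicator_of_mem ht]
      exact (hK t ht).trans (le_add_of_nonneg_left (by positivity))
    · have hfar : 1 ≤ |t - w.re| := by
        by_contra! h
        exact ht ⟨by linarith [neg_abs_le (t - w.re)], by linarith [le_abs_self (t - w.re)]⟩
      have hre : |t - w.re| ≤ ‖(t : ℂ) - w‖ := by simpa using Complex.abs_re_le_norm ((t : ℂ) - w)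
      have hle : ‖(t : ℂ) - z‖ ≤ |t - w.re| + 1 := by
        simpa [hz, ← sub_sub, ← Complex.ofReal_sub] using norm_sub_le ((t : ℂ) - w.re) Complex.I
      simp only [Pi.add_apply, Set.indicator_of_notMem ht, add_zero, norm_mul, ← mul_assoc]
      gcongr
      linarith
  refine (hzp.mul' (memLp_inv_sub_add_I w.re)).ae_eq (ae_of_all _ fun t => ?_)
  exact inv_mul_cancel_left₀ (hne t) (p t)

theorem exists_analytic_div_sub {u : ℂ → ℂ} (hu : AnalyticOnNhd ℂ u {z | 0 ≤ z.im}) {w : ℂ}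
    (hw : 0 ≤ w.im → u w = 0) :
    ∃ p : ℂ → ℂ, AnalyticOnNhd ℂ p {z | 0 ≤ z.im} ∧ ∀ z : ℂ, 0 ≤ z.im → (z - w) * p z = u z := by
  rcases le_or_gt 0 w.im with him | him
  · have hopen : IsOpen {z | AnalyticAt ℂ u z} := isOpen_analyticAt ℂ u
    have hdiff : DifferentiableOn ℂ (dslope u w) {z | AnalyticAt ℂ u z} :=
      (Complex.differentiableOn_dslope (hopen.mem_nhds (hu w him))).2
        fun z hz => hz.differentiableAt.differentiableWithinAt
    exact ⟨dslope u w, fun z hz => hdiff.analyticOnNhd hopen z (hu z hz), fun z _ => by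
      simpa [hw him] using sub_smul_dslope u w z⟩
  · have hne : ∀ z ∈ {z : ℂ | 0 ≤ z.im}, z - w ≠ 0 := fun z hz h =>
      (him.trans_le hz).ne' (by rw [sub_eq_zero.1 h])
    exact ⟨fun z => u z / (z - w), hu.div (analyticOnNhd_id.sub analyticOnNhd_const) hne,
      fun z hz => mul_div_cancel₀ _ (hne z hz)⟩

namespace IsHardy

variable {p q r s : ℝ≥0∞} {u v : ℂ → ℂ}

theorem const (c : ℂ) : IsHardy ∞ fun _ => c :=
  ⟨analyticOnNhd_const, IsTame.of_norm_le (differentiableOn_const c) fun _ _ => le_rfl,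
    memLp_top_const c⟩

theorem add (hu : IsHardy p u) (hv : IsHardy p v) : IsHardy p fun z => u z + v z :=
  ⟨hu.analytic.add hv.analytic, hu.tame.add hv.tame, hu.memLp.add hv.memLp⟩

theorem mul [ENNReal.HolderTriple p q r] (hu : IsHardy p u) (hv : IsHardy q v) :
    IsHardy r fun z => u z * v z :=
  ⟨hu.analytic.mul hv.analytic, hu.tame.mul hv.tame, hv.memLp.mul' hu.memLp⟩

theorem const_mul (c : ℂ) (hu : IsHardy p u) : IsHardy p fun z => c * u z :=
  (const c).mul hu

theorem exists_div_sub [ENNReal.HolderTriple 2 r s] (hu : IsHardy r u) {w : ℂ}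
    (hw : 0 ≤ w.im → u w = 0) :
    ∃ p : ℂ → ℂ, IsHardy s p ∧ ∀ z : ℂ, 0 ≤ z.im → (z - w) * p z = u z := by
  obtain ⟨p, hp, hpu⟩ := exists_analytic_div_sub hu.analytic hw
  have htame : IsTame p := IsTame.of_sub_mul (a := w)
    (hp.differentiableOn.mono fun z (hz : 0 < z.im) => hz.le)
    (hu.tame.congr fun z hz => hpu z hz.le)
  have hcont : Continuous fun t : ℝ => p t :=
    hp.continuousOn.comp_continuous Complex.continuous_ofReal fun _ => by simp
  have hmemLp : MemLp (fun t : ℝ => (t - w) * p t) r :=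
    hu.memLp.ae_eq (ae_of_all _ fun t => (hpu t (by simp)).symm)
  exact ⟨p, ⟨hp, htame, memLp_of_sub_mul hcont hmemLp⟩, hpu⟩

end IsHardy

end HardyDivision

section HardyMultiple

variable {E F f g : ℂ → ℂ} {p q r s : ℝ≥0∞}

/-- `f / E` is a function of the Hardy space `H^p` of the upper half-plane. The quotient is given
by a function `u` with `u E = f`, since `E` may vanish on the real line. -/
def IsHardyMultiple (p : ℝ≥0∞) (E f : ℂ → ℂ) : Prop :=
  ∃ u : ℂ → ℂ, IsHardy p u ∧ ∀ z : ℂ, 0 ≤ z.im → u z * E z = f z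

namespace IsHardyMultiple

theorem refl (E : ℂ → ℂ) : IsHardyMultiple ∞ E E :=
  ⟨_, IsHardy.const 1, fun z _ => one_mul (E z)⟩

theorem zero (E : ℂ → ℂ) : IsHardyMultiple p E 0 :=
  ⟨fun _ => 0, ⟨analyticOnNhd_const, (IsHardy.const 0).tame, MemLp.zero⟩, fun z _ => zero_mul (E z)⟩

theorem add (hf : IsHardyMultiple p E f) (hg : IsHardyMultiple p E g) :
    IsHardyMultiple p E (f + g) := by
  obtain ⟨u, hu, huE⟩ := hf
  obtain ⟨v, hv, hvE⟩ := hg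
  exact ⟨_, hu.add hv, fun z hz => by rw [add_mul, huE z hz, hvE z hz, Pi.add_apply]⟩

theorem const_smul (c : ℂ) (hf : IsHardyMultiple p E f) : IsHardyMultiple p E (c • f) := by
  obtain ⟨u, hu, huE⟩ := hf
  exact ⟨_, hu.const_mul c, fun z hz => by rw [mul_assoc, huE z hz, Pi.smul_apply, smul_eq_mul]⟩

theorem mul [ENNReal.HolderTriple p q r] (hf : IsHardyMultiple p E f)
    (hg : IsHardyMultiple q F g) : IsHardyMultiple r (E * F) (f * g) := by
  obtain ⟨u, hu, huE⟩ := hf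
  obtain ⟨v, hv, hvF⟩ := hg
  refine ⟨_, hu.mul (r := r) hv, fun z hz => ?_⟩
  rw [Pi.mul_apply, Pi.mul_apply, mul_mul_mul_comm, huE z hz, hvF z hz]

theorem of_sub_mul [ENNReal.HolderTriple 2 r s] (hE : Differentiable ℂ E)
    (hf : Differentiable ℂ f) {u : ℂ → ℂ} (hu : IsHardy r u) {w : ℂ} (hw : 0 ≤ w.im → u w = 0)
    (huE : ∀ z : ℂ, 0 ≤ z.im → u z * E z = (z - w) * f z) : IsHardyMultiple s E f := by
  obtain ⟨p, hp, hpu⟩ := hu.exists_div_sub (s := s) hw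
  have hcancel := AnalyticOnNhd.eq_zero_or_eq_zero_of_mul_eq_zero (U := {z : ℂ | 0 ≤ z.im})
    (f := fun z => z - w) (g := fun z => p z * E z - f z)
    (analyticOnNhd_id.sub analyticOnNhd_const)
    ((hp.analytic.mul fun z _ => hE.analyticAt z).sub fun z _ => hf.analyticAt z)
    (fun z hz => by linear_combination E z * hpu z hz + huE z hz)
    (convex_halfSpace_im_ge 0).isPreconnected
  refine ⟨p, hp, fun z hz => sub_eq_zero.1 (hcancel.resolve_left (fun hzero => ?_) z hz)⟩
  have hzero₀ := hzero 0 (by simp)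
  have hzero₁ := hzero 1 (by simp)
  exact one_ne_zero (by linear_combination hzero₁ - hzero₀ : (1 : ℂ) = 0)

end IsHardyMultiple

namespace IsHermiteBiehler

theorem isHardyMultiple_iff (hE : IsHermiteBiehler E) (hf : Differentiable ℂ f) (hp : 1 ≤ p) :
    IsHardyMultiple p E f ↔
      IsTame (fun z => f z / E z) ∧ MemLp (fun t : ℝ => f t / E t) p := by
  constructor
  · rintro ⟨u, hu, huE⟩
    refine ⟨hu.tame.congr fun z hz => ?_, hu.memLp.ae_eq ?_⟩
    · rw [← huE z hz.le, mul_div_cancel_right₀ _ (hE.ne_zero hz)]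
    · filter_upwards [hE.ae_ne_zero] with t ht
      rw [← huE t (by simp), mul_div_cancel_right₀ _ ht]
  · rintro ⟨htame, hLp⟩
    obtain ⟨u, hu, huE⟩ := hE.exists_analytic_quotient hf (hLp.locallyIntegrable hp)
    refine ⟨u, ⟨hu, htame.congr fun z hz => ?_, hLp.ae_eq ?_⟩, huE⟩
    · rw [← huE z hz.le, mul_div_cancel_right₀ _ (hE.ne_zero hz)]
    · filter_upwards [hE.ae_ne_zero] with t ht
      rw [← huE t (by simp), mul_div_cancel_right₀ _ ht]

theorem norm_entireStar_le (hE : IsHermiteBiehler E) {z : ℂ} (hz : 0 ≤ z.im) :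
    ‖entireStar E z‖ ≤ ‖E z‖ := by
  rw [entireStar, RCLike.norm_conj]
  rcases hz.eq_or_lt with hreal | hpos
  · rw [Complex.conj_eq_iff_im.2 hreal.symm]
  · exact (hE.norm_conj_lt z hpos).le

end IsHermiteBiehler

theorem aestronglyMeasurable_div_ofReal (hf : Differentiable ℂ f) (hE : Differentiable ℂ E) :
    AEStronglyMeasurable fun t : ℝ => f t / E t :=
  ((hf.continuous.comp Complex.continuous_ofReal).measurable.div
    (hE.continuous.comp Complex.continuous_ofReal).measurable).aestronglyMeasurable

theorem IsHermiteBiehler.isHardyMultiple_entireStar (hE : IsHermiteBiehler E) :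
    IsHardyMultiple ∞ E (entireStar E) := by
  have hstar := differentiable_entireStar hE.entire
  have hle {z : ℂ} (hz : 0 ≤ z.im) : ‖entireStar E z / E z‖ ≤ 1 := by
    rw [norm_div]
    exact div_le_one_of_le₀ (hE.norm_entireStar_le hz) (norm_nonneg _)
  exact (hE.isHardyMultiple_iff hstar le_top).2
    ⟨IsTame.of_norm_le (hstar.differentiableOn.div hE.entire.differentiableOn
      fun z hz => hE.ne_zero hz) fun z hz => hle hz.le,
    memLp_top_of_bound (aestronglyMeasurable_div_ofReal hstar hE.entire) 1
      (ae_of_all _ fun t => hle (by simp))⟩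

end HardyMultiple

section DeBrangesSpace

variable {E f : ℂ → ℂ}

theorem deBrangesNormSq_eq_eLpNorm_sq (E f : ℂ → ℂ) :
    deBrangesNormSq E f = eLpNorm (fun t : ℝ => f t / E t) 2 ^ 2 := by
  simpa [deBrangesNormSq] using (eLpNorm_nnreal_pow_eq_lintegral (μ := volume)
    (f := fun t : ℝ => f t / E t) (p := 2) two_ne_zero).symm

theorem deBrangesNormSq_entireStar (E f : ℂ → ℂ) :
    deBrangesNormSq E (entireStar f) = deBrangesNormSq E f := by
  refine lintegral_congr fun t => ?_
  rw [entireStar_ofReal, ← ofReal_norm, ← ofReal_norm, norm_div, norm_div, RCLike.norm_conj]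

theorem memLp_div_iff (hf : Differentiable ℂ f) (hE : Differentiable ℂ E) :
    MemLp (fun t : ℝ => f t / E t) 2 ↔ deBrangesNormSq E f < ∞ := by
  rw [deBrangesNormSq_eq_eLpNorm_sq, ENNReal.pow_lt_top_iff]
  simp [MemLp, aestronglyMeasurable_div_ofReal hf hE]

namespace IsHermiteBiehler

theorem mem_deBrangesSpace_iff (hE : IsHermiteBiehler E) :
    f ∈ deBrangesSpace E ↔ Differentiable ℂ f ∧ IsHardyMultiple 2 E f ∧
      IsHardyMultiple 2 E (entireStar f) := by
  refine and_congr_right fun hf => ?_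
  have hstar := differentiable_entireStar hf
  rw [hE.isHardyMultiple_iff hf one_le_two, hE.isHardyMultiple_iff hstar one_le_two,
    memLp_div_iff hf hE.entire, memLp_div_iff hstar hE.entire, deBrangesNormSq_entireStar,
    IsTame, IsTame]
  tauto

theorem memLp_div (hE : IsHermiteBiehler E) (hf : f ∈ deBrangesSpace E) :
    MemLp (fun t : ℝ => f t / E t) 2 :=
  (memLp_div_iff hf.1 hE.entire).2 hf.2.1

end IsHermiteBiehler

theorem entireStar_add (f g : ℂ → ℂ) : entireStar (f + g) = entireStar f + entireStar g := by
  ext z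
  simp [entireStar]

theorem entireStar_smul (c : ℂ) (f : ℂ → ℂ) : entireStar (c • f) = conj c • entireStar f := by
  ext z
  simp [entireStar]

/-- The de Branges space `H(E)` as a space of functions on `ℂ`. -/
def deBrangesSubmodule (hE : IsHermiteBiehler E) : Submodule ℂ (ℂ → ℂ) where
  carrier := deBrangesSpace E
  zero_mem' := by
    have hstar : entireStar 0 = 0 := by simpa using entireStar_smul 0 0
    rw [hE.mem_deBrangesSpace_iff, hstar]
    exact ⟨differentiable_const 0, .zero E, .zero E⟩
  add_mem' {f g} hf hg := by
    rw [hE.mem_deBrangesSpace_iff] at hf hg ⊢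
    rw [entireStar_add]
    exact ⟨hf.1.add hg.1, hf.2.1.add hg.2.1, hf.2.2.add hg.2.2⟩
  smul_mem' c f hf := by
    rw [hE.mem_deBrangesSpace_iff] at hf ⊢
    rw [entireStar_smul]
    exact ⟨hf.1.const_smul c, hf.2.1.const_smul c, hf.2.2.const_smul _⟩

namespace IsHermiteBiehler

/-- The isometric embedding `f ↦ f / E` of the de Branges space into `L²(ℝ)`. -/
noncomputable def toL2 (hE : IsHermiteBiehler E) :
    deBrangesSubmodule hE →ₗ[ℂ] Lp ℂ 2 (volume : Measure ℝ) where
  toFun f := (hE.memLp_div f.2).toLp _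
  map_add' f g := by
    rw [← MemLp.toLp_add]
    exact MemLp.toLp_congr _ _ (ae_of_all _ fun t => add_div _ _ _)
  map_smul' c f := by
    rw [RingHom.id_apply, ← MemLp.toLp_const_smul]
    exact MemLp.toLp_congr _ _ (ae_of_all _ fun t => mul_div_assoc _ _ _)

theorem coeFn_toL2 (hE : IsHermiteBiehler E) (f : deBrangesSubmodule hE) :
    hE.toL2 f =ᵐ[volume] fun t : ℝ => f.1 t / E t :=
  (hE.memLp_div f.2).coeFn_toLp

theorem enorm_toL2_sq (hE : IsHermiteBiehler E) (f : deBrangesSubmodule hE) :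
    ‖hE.toL2 f‖ₑ ^ 2 = deBrangesNormSq E f.1 := by
  rw [deBrangesNormSq_eq_eLpNorm_sq, Lp.enorm_def, eLpNorm_congr_ae (hE.coeFn_toL2 f)]

theorem inner_toL2 (hE : IsHermiteBiehler E) (f g : deBrangesSubmodule hE) :
    inner ℂ (hE.toL2 f) (hE.toL2 g) = ∫ t : ℝ, conj (f.1 t / E t) * (g.1 t / E t) := by
  rw [L2.inner_def]
  refine integral_congr_ae ?_
  filter_upwards [hE.coeFn_toL2 f, hE.coeFn_toL2 g] with t hf hg
  rw [hf, hg, RCLike.inner_apply, mul_comm]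

end IsHermiteBiehler

end DeBrangesSpace

section ReproducingKernel

variable {E : ℂ → ℂ}

theorem kernelNumerator_conj (E : ℂ → ℂ) (w : ℂ) : kernelNumerator E w (conj w) = 0 := by
  simp only [kernelNumerator, entireStar, Complex.conj_conj]
  ring

theorem deBrangesKernel_eq_dslope (E : ℂ → ℂ) (w z : ℂ) :
    deBrangesKernel E w z =
      -(2 * Real.pi * Complex.I)⁻¹ * dslope (kernelNumerator E w) (conj w) z := by
  unfold deBrangesKernel
  split_ifs with hz
  · rw [hz, dslope_same]
    ring
  · have hsub : z - conj w ≠ 0 := sub_ne_zero.2 hz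
    rw [dslope_of_ne _ hz, slope_def_module, kernelNumerator_conj, sub_zero, smul_eq_mul,
      ← neg_sub z]
    field_simp

theorem deBrangesKernel_mul_sub (E : ℂ → ℂ) (w z : ℂ) :
    deBrangesKernel E w z * (2 * Real.pi * Complex.I * (conj w - z)) = kernelNumerator E w z := by
  have hslope := sub_smul_dslope (kernelNumerator E w) (conj w) z
  rw [kernelNumerator_conj, sub_zero, smul_eq_mul] at hslope
  rw [deBrangesKernel_eq_dslope, ← hslope]
  field_simp [Complex.two_pi_I_ne_zero]
  ring

theorem differentiable_deBrangesKernel (hE : Differentiable ℂ E) (w : ℂ) :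
    Differentiable ℂ (deBrangesKernel E w) := by
  have hstar := differentiable_entireStar hE
  have hnum : Differentiable ℂ (kernelNumerator E w) :=
    (hE.const_mul (conj (E w))).sub (hstar.const_mul (E (conj w)))
  have hslope : Differentiable ℂ (dslope (kernelNumerator E w) (conj w)) := by
    rw [← differentiableOn_univ, Complex.differentiableOn_dslope univ_mem]
    exact hnum.differentiableOn
  rw [funext (deBrangesKernel_eq_dslope E w)]
  exact hslope.const_mul _

theorem eq_deBrangesKernel_of_mul_sub {k : ℂ → ℂ} {w : ℂ} (hE : Differentiable ℂ E)
    (hk : Continuous k)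
    (hkE : ∀ z, k z * (2 * Real.pi * Complex.I * (conj w - z)) = kernelNumerator E w z) :
    k = deBrangesKernel E w := by
  refine Continuous.ext_on (dense_compl_singleton (conj w)) hk
    (differentiable_deBrangesKernel hE w).continuous fun z hz => ?_
  refine mul_right_cancel₀ (mul_ne_zero Complex.two_pi_I_ne_zero (sub_ne_zero.2 (Ne.symm hz)))
    ((hkE z).trans (deBrangesKernel_mul_sub E w z).symm)

theorem entireStar_deBrangesKernel (hE : Differentiable ℂ E) (w : ℂ) :
    entireStar (deBrangesKernel E w) = deBrangesKernel E (conj w) := by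
  refine eq_deBrangesKernel_of_mul_sub hE
    (differentiable_entireStar (differentiable_deBrangesKernel hE w)).continuous fun z => ?_
  have hconj := congrArg conj (deBrangesKernel_mul_sub E w (conj z))
  simp only [kernelNumerator, entireStar, map_mul, map_sub, Complex.conj_conj, map_ofNat,
    Complex.conj_ofReal, Complex.conj_I] at hconj ⊢
  linear_combination -hconj

namespace IsHermiteBiehler

theorem isHardyMultiple_deBrangesKernel (hE : IsHermiteBiehler E) (w : ℂ) :
    IsHardyMultiple 2 E (deBrangesKernel E w) := by
  obtain ⟨θ, hθ, hθE⟩ := hE.isHardyMultiple_entireStar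
  have hnum : IsHardy ∞ fun z => -(2 * Real.pi * Complex.I)⁻¹ *
      (conj (E w) + -E (conj w) * θ z) :=
    ((IsHardy.const _).add (hθ.const_mul _)).const_mul _
  refine IsHardyMultiple.of_sub_mul hE.entire (differentiable_deBrangesKernel hE.entire w) hnum
    (w := conj w) (fun hw => ?_) fun z hz => ?_
  · have hθw := hθE (conj w) hw
    rw [entireStar, Complex.conj_conj] at hθw
    linear_combination (2 * Real.pi * Complex.I)⁻¹ * hθw
  · have hker := deBrangesKernel_mul_sub E w z
    rw [kernelNumerator] at hker
    linear_combination (2 * Real.pi * Complex.I)⁻¹ * (E (conj w) * hθE z hz + hker) -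
      deBrangesKernel E w z * (conj w - z) * inv_mul_cancel₀ Complex.two_pi_I_ne_zero

theorem deBrangesKernel_mem (hE : IsHermiteBiehler E) (w : ℂ) :
    deBrangesKernel E w ∈ deBrangesSpace E := by
  rw [hE.mem_deBrangesSpace_iff, entireStar_deBrangesKernel hE.entire]
  exact ⟨differentiable_deBrangesKernel hE.entire w, hE.isHardyMultiple_deBrangesKernel w,
    hE.isHardyMultiple_deBrangesKernel (conj w)⟩

/-- The reproducing kernel `K_E(w, ·)` as an element of `H(E)`. -/
noncomputable def kernelElem (hE : IsHermiteBiehler E) (w : ℂ) : deBrangesSubmodule hE :=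
  ⟨deBrangesKernel E w, hE.deBrangesKernel_mem w⟩

end IsHermiteBiehler

theorem IsHardy.exists_sub_mul_eq {u : ℂ → ℂ} (hu : IsHardy 2 u) {w a b : ℂ}
    (hab : 0 ≤ w.im → b * u w = a) : ∃ p : ℂ → ℂ, IsHardy 1 p ∧
      ∀ z : ℂ, 0 ≤ z.im → (z - w) * p z = b * u z - a * ((w + Complex.I) / (z + Complex.I)) := by
  obtain ⟨k, hk, hkI⟩ := (IsHardy.const 1).exists_div_sub (s := 2) (w := -Complex.I)
    (fun h => absurd h (by simp))
  have hk_eq {z : ℂ} (hz : 0 ≤ z.im) : k z = (z + Complex.I)⁻¹ :=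
    eq_inv_of_mul_eq_one_right (by simpa using hkI z hz)
  have hpole := (hu.const_mul b).add (hk.const_mul (-(a * (w + Complex.I))))
  obtain ⟨p, hp, hpu⟩ := hpole.exists_div_sub (s := 1) (w := w) fun hw => by
    rw [hab hw, hk_eq hw, neg_mul, mul_inv_cancel_right₀ (add_I_ne_zero hw), add_neg_cancel]
  refine ⟨p, hp, fun z hz => ?_⟩
  rw [hpu z hz, hk_eq hz]
  ring

theorem conj_deBrangesKernel_div_mul {f u v : ℂ → ℂ} {w : ℂ} {t : ℝ} (hE : E t ≠ 0)
    (hw : (t : ℂ) ≠ w) (hu : u t * E t = f t) (hv : v t * E t = entireStar f t) :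
    conj (deBrangesKernel E w t / E t) * (f t / E t) =
      (2 * Real.pi * Complex.I)⁻¹ * ((E w * u t - conj (E (conj w)) * conj (v t)) / (t - w)) := by
  have hker := congrArg conj (deBrangesKernel_mul_sub E w t)
  have hv_conj := congrArg conj hv
  have hE_conj : conj (E t) ≠ 0 := (map_ne_zero _).2 hE
  have hsub : (t : ℂ) - w ≠ 0 := sub_ne_zero.2 hw
  simp only [kernelNumerator, entireStar_ofReal, map_mul, map_sub, Complex.conj_conj, map_ofNat,
    Complex.conj_ofReal, Complex.conj_I] at hker hv_conj
  rw [map_div₀, eq_inv_mul_iff_mul_eq₀ Complex.two_pi_I_ne_zero, eq_div_iff hsub, ← hu,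
    mul_div_cancel_right₀ _ hE]
  field_simp
  rw [← hu] at hv_conj
  linear_combination u t * hker + conj (E (conj w)) * hv_conj

theorem ae_ne_ofReal (w : ℂ) : ∀ᵐ t : ℝ, (t : ℂ) ≠ w := by
  have hcompl : ({w.re} : Set ℝ)ᶜ ∈ ae volume := compl_mem_ae_iff.2 (by simp)
  filter_upwards [hcompl] with t ht htw
  exact ht (by simp [← htw])

theorem div_add_I_sub_div_sub_I (w : ℂ) (t : ℝ) :
    (w + Complex.I) / (t + Complex.I) - (w - Complex.I) / (t - Complex.I) =
      (t - w) * (2 * Complex.I) * ((1 + t ^ 2)⁻¹ : ℝ) := by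
  have hadd : (t : ℂ) + Complex.I ≠ 0 := add_I_ne_zero (by simp)
  have hsub : (t : ℂ) - Complex.I ≠ 0 := ofReal_sub_ne_zero (by simp) t
  have hsq : 1 + (t : ℂ) ^ 2 = (t + Complex.I) * (t - Complex.I) := by
    linear_combination Complex.I_sq
  push_cast
  rw [hsq]
  field_simp
  ring

namespace IsHermiteBiehler

theorem inner_kernelElem (hE : IsHermiteBiehler E) (w : ℂ) (f : deBrangesSubmodule hE) :
    inner ℂ (hE.toL2 (hE.kernelElem w)) (hE.toL2 f) = f.1 w := by
  obtain ⟨-, ⟨u, hu, huE⟩, v, hv, hvE⟩ := hE.mem_deBrangesSpace_iff.1 f.2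
  obtain ⟨p, hp, hpu⟩ := hu.exists_sub_mul_eq (w := w) (a := f.1 w) (b := E w) fun hw => by
    rw [mul_comm, huE w hw]
  obtain ⟨q, hq, hqv⟩ := hv.exists_sub_mul_eq (w := conj w) (a := conj (f.1 w)) (b := E (conj w))
    fun hw => by rw [mul_comm, hvE _ hw, entireStar, Complex.conj_conj]
  have hdecomp : (fun t : ℝ => conj (deBrangesKernel E w t / E t) * (f.1 t / E t)) =ᵐ[volume]
      fun t => (2 * Real.pi * Complex.I)⁻¹ *
        (p t - conj (q t) + f.1 w * (2 * Complex.I) * ((1 + t ^ 2)⁻¹ : ℝ)) := by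
    filter_upwards [hE.ae_ne_zero, ae_ne_ofReal w] with t hEt htw
    have hqt := congrArg conj (hqv t (by simp))
    simp only [map_mul, map_sub, map_add, map_div₀, Complex.conj_conj, Complex.conj_ofReal,
      Complex.conj_I, ← sub_eq_add_neg] at hqt
    rw [conj_deBrangesKernel_div_mul hEt htw (huE t (by simp)) (hvE t (by simp))]
    congr 1
    rw [div_eq_iff (sub_ne_zero.2 htw)]
    linear_combination -hpu t (by simp) + hqt + f.1 w * div_add_I_sub_div_sub_I w t
  have hp_int : Integrable fun t : ℝ => p t := memLp_one_iff_integrable.1 hp.memLp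
  have hq_int : Integrable fun t : ℝ => conj (q t) :=
    (Complex.conjCLE : ℂ ≃L[ℝ] ℂ).integrable_comp_iff.2 (memLp_one_iff_integrable.1 hq.memLp)
  have hpq_int : Integrable fun t : ℝ => p t - conj (q t) := hp_int.sub hq_int
  have hpoisson_int : Integrable fun t : ℝ => f.1 w * (2 * Complex.I) * ((1 + t ^ 2)⁻¹ : ℝ) :=
    integrable_inv_one_add_sq.ofReal.const_mul _
  rw [hE.inner_toL2]
  simp only [kernelElem]
  rw [integral_congr_ae hdecomp, integral_const_mul,
    integral_add hpq_int hpoisson_int, integral_sub hp_int hq_int, integral_conj,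
    hp.integral_eq_zero, hq.integral_eq_zero,
    integral_const_mul, integral_complex_ofReal, integral_univ_inv_one_add_sq]
  simp only [map_zero, sub_zero, zero_add]
  field_simp

end IsHermiteBiehler

end ReproducingKernel

section Sampling

theorem hasSum_map_of_norm_map_le {ι 𝕜 V X Y : Type*} [Semiring 𝕜] [AddCommGroup V] [Module 𝕜 V]
    [SeminormedAddCommGroup X] [Module 𝕜 X] [SeminormedAddCommGroup Y] [Module 𝕜 Y]
    (a : V →ₗ[𝕜] X) (b : V →ₗ[𝕜] Y) (hab : ∀ v, ‖a v‖ ≤ ‖b v‖) {x : ι → V} {v : V}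
    (hx : HasSum (fun i => b (x i)) (b v)) : HasSum (fun i => a (x i)) (a v) := by
  rw [HasSum, tendsto_iff_norm_sub_tendsto_zero] at hx ⊢
  simp only [← map_sum, ← map_sub] at hx ⊢
  exact squeeze_zero (fun _ => norm_nonneg _) (fun s => hab _) hx

theorem starProjection_span_image_of_orthogonal {ι H : Type*} [NormedAddCommGroup H]
    [InnerProductSpace ℂ H] {e : ι → H} (he : Pairwise fun m n => inner ℂ (e m) (e n) = 0)
    (s : Finset ι) [(Submodule.span ℂ (e '' s)).HasOrthogonalProjection] (x : H) :
    (Submodule.span ℂ (e '' s)).starProjection x =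
      ∑ n ∈ s, (inner ℂ (e n) x / inner ℂ (e n) (e n)) • e n := by
  set y := ∑ n ∈ s, (inner ℂ (e n) x / inner ℂ (e n) (e n)) • e n with hy
  have hmem : y ∈ Submodule.span ℂ (e '' s) :=
    Submodule.sum_mem _ fun n hn => Submodule.smul_mem _ _
      (Submodule.subset_span (Set.mem_image_of_mem e hn))
  have horth (n : ι) (hn : n ∈ s) : inner ℂ (e n) (x - y) = 0 := by
    rw [inner_sub_right, hy, inner_sum, Finset.sum_eq_single_of_mem n hn
      fun m _ hmn => by rw [inner_smul_right, he hmn.symm, mul_zero], inner_smul_right]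
    rcases eq_or_ne (e n) 0 with hzero | hne
    · simp [hzero]
    · rw [div_mul_cancel₀ _ (inner_self_ne_zero.2 hne), sub_self]
  refine Submodule.eq_starProjection_of_mem_orthogonal hmem ?_
  rw [← Submodule.span_singleton_le_iff_mem, ← Submodule.isOrtho_iff_le, Submodule.isOrtho_comm,
    Submodule.isOrtho_span]
  rintro _ ⟨n, hn, rfl⟩ _ rfl
  exact horth n hn

theorem hasSum_of_orthogonal_of_mem_closure_span {ι H : Type*} [NormedAddCommGroup H]
    [InnerProductSpace ℂ H] [CompleteSpace H] {e : ι → H}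
    (he : Pairwise fun m n => inner ℂ (e m) (e n) = 0) {x : H}
    (hx : x ∈ (Submodule.span ℂ (Set.range e)).topologicalClosure) :
    HasSum (fun n => (inner ℂ (e n) x / inner ℂ (e n) (e n)) • e n) x := by
  let U (s : Finset ι) : Submodule ℂ H := Submodule.span ℂ (e '' s)
  have hfin (s : Finset ι) : FiniteDimensional ℂ (U s) :=
    FiniteDimensional.span_of_finite ℂ (s.finite_toSet.image e)
  have hU : Monotone U := fun s t hst => Submodule.span_mono (Set.image_mono hst)
  have hiSup : ⨆ s, U s = Submodule.span ℂ (Set.range e) := by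
    refine le_antisymm (iSup_le fun s => Submodule.span_mono (Set.image_subset_range e s)) ?_
    rw [Submodule.span_le]
    rintro _ ⟨n, rfl⟩
    exact Submodule.mem_iSup_of_mem {n} (Submodule.subset_span ⟨n, by simp, rfl⟩)
  have hlim := Submodule.starProjection_tendsto_closure_iSup U hU x
  rw [hiSup, Submodule.starProjection_eq_self_iff.2 hx] at hlim
  rw [HasSum, SummationFilter.unconditional_filter]
  exact hlim.congr fun s => starProjection_span_image_of_orthogonal he s x

variable {ι : Type*} {E : ℂ → ℂ}

theorem IsCompleteIn.mem_closure_span {hE : IsHermiteBiehler E} {k : ι → deBrangesSubmodule hE}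
    (hk : IsCompleteIn E fun n => (k n).1) (h : deBrangesSubmodule hE) :
    hE.toL2 h ∈ (Submodule.span ℂ (Set.range fun n => hE.toL2 (k n))).topologicalClosure := by
  refine EMetric.mem_closure_iff.2 fun ε hε => ?_
  obtain ⟨p, hp, hlt⟩ := hk h.1 h.2 (ε ^ 2) (by positivity)
  have hrange : (Set.range fun n => (k n).1) =
      (deBrangesSubmodule hE).subtype '' Set.range k := (Set.range_comp _ k)
  rw [hrange, Submodule.span_image] at hp
  obtain ⟨q, hq, rfl⟩ := hp
  refine ⟨hE.toL2 q, ?_, ?_⟩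
  · rw [Set.range_comp' hE.toL2 k, Submodule.span_image]
    exact Submodule.mem_map_of_mem hq
  · rw [edist_eq_enorm_sub, ← map_sub]
    refine (ENNReal.pow_right_strictMono two_ne_zero).lt_iff_lt.1 ?_
    rwa [hE.enorm_toL2_sq]

namespace IsHermiteBiehler

theorem hasSum_kernelElem (hE : IsHermiteBiehler E) {w : ι → ℂ}
    (horth : Pairwise fun m n => deBrangesKernel E (w m) (w n) = 0)
    (hcomplete : IsCompleteIn E fun n => deBrangesKernel E (w n)) (h : deBrangesSubmodule hE) :
    HasSum (fun n => hE.toL2 ((h.1 (w n) / deBrangesKernel E (w n) (w n)) • hE.kernelElem (w n)))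
      (hE.toL2 h) := by
  have horth' : Pairwise fun m n =>
      inner ℂ (hE.toL2 (hE.kernelElem (w m))) (hE.toL2 (hE.kernelElem (w n))) = 0 :=
    fun m n hmn => (hE.inner_kernelElem _ _).trans (horth hmn.symm)
  have hmem := IsCompleteIn.mem_closure_span (k := fun n => hE.kernelElem (w n)) hcomplete h
  convert hasSum_of_orthogonal_of_mem_closure_span horth' hmem using 2 with n
  rw [map_smul, hE.inner_kernelElem, hE.inner_kernelElem, kernelElem]

theorem hasSum_apply (hE : IsHermiteBiehler E) {x : ι → deBrangesSubmodule hE}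
    {f : deBrangesSubmodule hE} (hx : HasSum (fun n => hE.toL2 (x n)) (hE.toL2 f)) (z : ℂ) :
    HasSum (fun n => (x n).1 z) (f.1 z) := by
  simpa only [innerSL_apply_apply, hE.inner_kernelElem] using
    hx.mapL (innerSL ℂ (hE.toL2 (hE.kernelElem z)))

theorem tendsto_deBrangesNormSq_sub_sum (hE : IsHermiteBiehler E) {x : ι → deBrangesSubmodule hE}
    {f : deBrangesSubmodule hE} (hx : HasSum (fun n => hE.toL2 (x n)) (hE.toL2 f)) :
    Tendsto (fun s : Finset ι => deBrangesNormSq E fun z => f.1 z - ∑ n ∈ s, (x n).1 z) atTop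
      (𝓝 0) := by
  rw [HasSum, SummationFilter.unconditional_filter, tendsto_iff_edist_tendsto_0] at hx
  have hsq := ENNReal.Tendsto.pow (n := 2) hx
  rw [zero_pow two_ne_zero] at hsq
  refine hsq.congr fun s => ?_
  rw [edist_comm, edist_eq_enorm_sub, ← map_sum, ← map_sub, hE.enorm_toL2_sq]
  congr 1
  ext z
  simp

end IsHermiteBiehler

end Sampling

section Multiplexing

variable {E F f g : ℂ → ℂ}

theorem deBrangesKernel_mul (hE : Differentiable ℂ E) (hF : Differentiable ℂ F) (w : ℂ) :
    deBrangesKernel (E * F) w = multiplexedSample E F (conj (F w) • deBrangesKernel E w)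
      (E (conj w) • deBrangesKernel F w) := by
  have hstar := differentiable_entireStar hE
  have hkE := differentiable_deBrangesKernel hE w
  have hkF := differentiable_deBrangesKernel hF w
  have hmux : Differentiable ℂ (multiplexedSample E F (conj (F w) • deBrangesKernel E w)
      (E (conj w) • deBrangesKernel F w)) :=
    ((hkE.const_smul _).mul hF).add ((hkF.const_smul _).mul hstar)
  refine (eq_deBrangesKernel_of_mul_sub (hE.mul hF) hmux.continuous fun z => ?_).symm
  have hE_sub := deBrangesKernel_mul_sub E w z
  have hF_sub := deBrangesKernel_mul_sub F w z
  simp only [kernelNumerator, multiplexedSample, entireStar, Pi.smul_apply, Pi.mul_apply,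
    smul_eq_mul, map_mul] at hE_sub hF_sub ⊢
  linear_combination conj (F w) * F z * hE_sub + E (conj w) * conj (E (conj z)) * hF_sub

namespace IsPhaseFunction

variable {φ : ℝ → ℝ}

theorem conj_apply (hφ : IsPhaseFunction E φ) (x : ℝ) :
    conj (E x) = E x * Complex.exp (2 * (Complex.I * φ x)) := by
  have hreal := Complex.conj_eq_iff_im.2 (hφ.real x)
  have hunit : conj (Complex.exp (Complex.I * φ x)) * Complex.exp (Complex.I * φ x) = 1 := by
    rw [← Complex.exp_conj, ← Complex.exp_add]
    simp
  rw [map_mul] at hreal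
  rw [two_mul, Complex.exp_add]
  linear_combination Complex.exp (Complex.I * φ x) * hreal - conj (E x) * hunit

theorem deBrangesKernel_eq_zero (hφ : IsPhaseFunction E φ) {x y : ℝ} (hxy : x ≠ y) {k : ℤ}
    (hk : φ x = φ y + k * Real.pi) : deBrangesKernel E x y = 0 := by
  have hexp : Complex.exp (2 * (Complex.I * φ x)) = Complex.exp (2 * (Complex.I * φ y)) := by
    refine Complex.exp_eq_exp_iff_exists_int.2 ⟨k, ?_⟩
    rw [hk]
    push_cast
    ring
  have hnum : kernelNumerator E x y = 0 := by
    rw [kernelNumerator, entireStar_ofReal, Complex.conj_ofReal, hφ.conj_apply, hφ.conj_apply, hexp]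
    ring
  have hsub : conj (x : ℂ) - y ≠ 0 := by
    rw [Complex.conj_ofReal]
    exact sub_ne_zero.2 (Complex.ofReal_injective.ne hxy)
  refine (mul_eq_zero.1 ((deBrangesKernel_mul_sub E x y).trans hnum)).resolve_right ?_
  exact mul_ne_zero Complex.two_pi_I_ne_zero hsub

theorem pairwise_deBrangesKernel_eq_zero {ι : Type*} (hφ : IsPhaseFunction E φ) {α : ℝ}
    {lam : ι → ℝ} {k : ι → ℤ} (hk : Function.Injective k)
    (hlam : ∀ n, φ (lam n) = k n * Real.pi + α) :
    Pairwise fun m n => deBrangesKernel E (lam m) (lam n) = 0 := by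
  intro m n hmn
  refine hφ.deBrangesKernel_eq_zero (k := k m - k n) (fun heq => hmn (hk ?_)) ?_
  · have hphase := (hlam m).symm.trans ((congrArg φ heq).trans (hlam n))
    exact Int.cast_injective (mul_right_cancel₀ Real.pi_ne_zero (add_right_cancel hphase))
  · rw [hlam, hlam, Int.cast_sub]
    ring

end IsPhaseFunction

theorem entireStar_mul (f g : ℂ → ℂ) : entireStar (f * g) = entireStar f * entireStar g := by
  ext z
  simp [entireStar]

namespace IsHermiteBiehler

theorem multiplexedSample_mem (hE : IsHermiteBiehler E) (hF : IsHermiteBiehler F)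
    (hf : f ∈ deBrangesSpace E) (hg : g ∈ deBrangesSpace F) :
    multiplexedSample E F f g ∈ deBrangesSpace (E * F) := by
  obtain ⟨hf_entire, hfE, hf_star⟩ := hE.mem_deBrangesSpace_iff.1 hf
  obtain ⟨hg_entire, hgF, hg_star⟩ := hF.mem_deBrangesSpace_iff.1 hg
  have hmux : multiplexedSample E F f g = f * F + entireStar E * g := by
    ext z
    simp only [multiplexedSample, Pi.add_apply, Pi.mul_apply, mul_comm]
  rw [(hE.mul hF).mem_deBrangesSpace_iff, hmux, entireStar_add, entireStar_mul, entireStar_mul,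
    entireStar_entireStar]
  exact ⟨(hf_entire.mul hF.entire).add ((differentiable_entireStar hE.entire).mul hg_entire),
    (hfE.mul (.refl F)).add (hE.isHardyMultiple_entireStar.mul hgF),
    (hf_star.mul hF.isHardyMultiple_entireStar).add ((IsHardyMultiple.refl E).mul hg_star)⟩

/-- The multiplexing map `(f, g) ↦ f F + g E*`, which embeds `H(E) × H(F)` isometrically in
`H(EF)`. -/
noncomputable def multiplex (hE : IsHermiteBiehler E) (hF : IsHermiteBiehler F) :
    deBrangesSubmodule hE × deBrangesSubmodule hF →ₗ[ℂ] deBrangesSubmodule (hE.mul hF) where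
  toFun p := ⟨multiplexedSample E F p.1.1 p.2.1, hE.multiplexedSample_mem hF p.1.2 p.2.2⟩
  map_add' p q := by
    ext z
    simp only [multiplexedSample, Prod.fst_add, Prod.snd_add, Submodule.coe_add, Pi.add_apply]
    ring
  map_smul' c p := by
    ext z
    simp only [multiplexedSample, Prod.smul_fst, Prod.smul_snd, Submodule.coe_smul, Pi.smul_apply,
      smul_eq_mul, RingHom.id_apply]
    ring

theorem coe_multiplex (hE : IsHermiteBiehler E) (hF : IsHermiteBiehler F)
    (p : deBrangesSubmodule hE × deBrangesSubmodule hF) :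
    (hE.multiplex hF p).1 = multiplexedSample E F p.1.1 p.2.1 :=
  rfl

theorem deBrangesNormSq_multiplexedSample_left (hF : IsHermiteBiehler F) (E f : ℂ → ℂ) :
    deBrangesNormSq (E * F) (multiplexedSample E F f 0) = deBrangesNormSq E f := by
  refine lintegral_congr_ae ?_
  filter_upwards [hF.ae_ne_zero] with t hFt
  simp only [multiplexedSample, Pi.mul_apply, Pi.zero_apply, zero_mul, add_zero,
    mul_div_mul_right _ _ hFt]

theorem deBrangesNormSq_multiplexedSample_right (hE : IsHermiteBiehler E) (F g : ℂ → ℂ) :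
    deBrangesNormSq (E * F) (multiplexedSample E F 0 g) = deBrangesNormSq F g := by
  refine lintegral_congr_ae ?_
  filter_upwards [hE.ae_ne_zero] with t hEt
  have hunit : ‖conj (E t) / E t‖ₑ = 1 := by
    rw [← ofReal_norm, norm_div, RCLike.norm_conj, div_self (norm_ne_zero_iff.2 hEt),
      ENNReal.ofReal_one]
  simp only [multiplexedSample, Pi.mul_apply, Pi.zero_apply, zero_mul, zero_add,
    entireStar_ofReal]
  rw [mul_comm, mul_div_mul_comm, enorm_mul, hunit, one_mul]

theorem inner_multiplex_left_right (hE : IsHermiteBiehler E) (hF : IsHermiteBiehler F)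
    (f : deBrangesSubmodule hE) (g : deBrangesSubmodule hF) :
    inner ℂ ((hE.mul hF).toL2 (hE.multiplex hF (f, 0)))
      ((hE.mul hF).toL2 (hE.multiplex hF (0, g))) = 0 := by
  obtain ⟨-, -, u, hu, huE⟩ := hE.mem_deBrangesSpace_iff.1 f.2
  obtain ⟨-, ⟨v, hv, hvF⟩, -⟩ := hF.mem_deBrangesSpace_iff.1 g.2
  rw [inner_toL2, ← (hu.mul (r := 1) hv).integral_eq_zero]
  refine integral_congr_ae ?_
  filter_upwards [hE.ae_ne_zero, hF.ae_ne_zero] with t hEt hFt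
  have hEt_conj : conj (E t) ≠ 0 := (map_ne_zero _).2 hEt
  have hFt_conj : conj (F t) ≠ 0 := (map_ne_zero _).2 hFt
  have hu_conj := huE t (by simp)
  rw [entireStar_ofReal] at hu_conj
  simp only [coe_multiplex, multiplexedSample, ZeroMemClass.coe_zero, Pi.zero_apply, zero_mul,
    add_zero, zero_add, Pi.mul_apply, entireStar_ofReal, map_div₀, map_mul, ← hu_conj,
    ← hvF t (by simp)]
  field_simp

theorem norm_toL2_sq (hE : IsHermiteBiehler E) (f : deBrangesSubmodule hE) :
    ‖hE.toL2 f‖ ^ 2 = (deBrangesNormSq E f.1).toReal := by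
  rw [← hE.enorm_toL2_sq, ENNReal.toReal_pow, toReal_enorm]

theorem norm_toL2_multiplex_sq (hE : IsHermiteBiehler E) (hF : IsHermiteBiehler F)
    (p : deBrangesSubmodule hE × deBrangesSubmodule hF) :
    ‖(hE.mul hF).toL2 (hE.multiplex hF p)‖ ^ 2 = ‖hE.toL2 p.1‖ ^ 2 + ‖hF.toL2 p.2‖ ^ 2 := by
  have hsplit : p = (p.1, 0) + (0, p.2) := by simp
  have hpyth := norm_add_sq_eq_norm_sq_add_norm_sq_of_inner_eq_zero _ _
    (hE.inner_multiplex_left_right hF p.1 p.2)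
  rw [← map_add, ← map_add, ← hsplit] at hpyth
  simp only [← sq, norm_toL2_sq, coe_multiplex, ZeroMemClass.coe_zero] at hpyth ⊢
  rw [hpyth, hF.deBrangesNormSq_multiplexedSample_left, hE.deBrangesNormSq_multiplexedSample_right]

/-- The pair of elements of `H(E)` and `H(F)` which is multiplexed into `K_{EF}(w, ·)`. -/
noncomputable def kernelPair (hE : IsHermiteBiehler E) (hF : IsHermiteBiehler F) (w : ℂ) :
    deBrangesSubmodule hE × deBrangesSubmodule hF :=
  (conj (F w) • hE.kernelElem w, E (conj w) • hF.kernelElem w)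

theorem multiplex_kernelPair (hE : IsHermiteBiehler E) (hF : IsHermiteBiehler F) (w : ℂ) :
    hE.multiplex hF (hE.kernelPair hF w) = (hE.mul hF).kernelElem w :=
  Subtype.ext (deBrangesKernel_mul hE.entire hF.entire w).symm

theorem hasSum_kernelPair {ι : Type*} (hE : IsHermiteBiehler E) (hF : IsHermiteBiehler F)
    {w : ι → ℂ} (horth : Pairwise fun m n => deBrangesKernel (E * F) (w m) (w n) = 0)
    (hcomplete : IsCompleteIn (E * F) fun n => deBrangesKernel (E * F) (w n))
    (p : deBrangesSubmodule hE × deBrangesSubmodule hF) {c : ι → ℂ}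
    (hc : ∀ n, c n = multiplexedSample E F p.1.1 p.2.1 (w n) /
      deBrangesKernel (E * F) (w n) (w n)) :
    HasSum (fun n => hE.toL2 (c n • hE.kernelPair hF (w n)).1) (hE.toL2 p.1) ∧
      HasSum (fun n => hF.toL2 (c n • hE.kernelPair hF (w n)).2) (hF.toL2 p.2) := by
  have hmux := (hE.mul hF).hasSum_kernelElem horth hcomplete (hE.multiplex hF p)
  simp only [coe_multiplex, ← hc, ← hE.multiplex_kernelPair hF, ← map_smul,
    ← LinearMap.comp_apply] at hmux
  have hnorm := hE.norm_toL2_multiplex_sq hF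
  have hfst (q : deBrangesSubmodule hE × deBrangesSubmodule hF) :
      ‖(hE.toL2 ∘ₗ LinearMap.fst ℂ _ _) q‖ ≤ ‖((hE.mul hF).toL2 ∘ₗ hE.multiplex hF) q‖ :=
    le_of_sq_le_sq ((hnorm q).symm ▸ le_add_of_nonneg_right (sq_nonneg _)) (norm_nonneg _)
  have hsnd (q : deBrangesSubmodule hE × deBrangesSubmodule hF) :
      ‖(hF.toL2 ∘ₗ LinearMap.snd ℂ _ _) q‖ ≤ ‖((hE.mul hF).toL2 ∘ₗ hE.multiplex hF) q‖ :=
    le_of_sq_le_sq ((hnorm q).symm ▸ le_add_of_nonneg_left (sq_nonneg _)) (norm_nonneg _)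
  have hsum_fst := hasSum_map_of_norm_map_le _ _ hfst hmux
  have hsum_snd := hasSum_map_of_norm_map_le _ _ hsnd hmux
  simp only [LinearMap.comp_apply, LinearMap.fst_apply, LinearMap.snd_apply] at hsum_fst hsum_snd
  exact ⟨hsum_fst, hsum_snd⟩

theorem smul_kernelPair_fst_apply (hE : IsHermiteBiehler E) (hF : IsHermiteBiehler F)
    (c w z : ℂ) :
    (c • hE.kernelPair hF w).1.1 z = c * (conj (F w) * deBrangesKernel E w z) :=
  rfl

theorem smul_kernelPair_snd_apply (hE : IsHermiteBiehler E) (hF : IsHermiteBiehler F)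
    (c w z : ℂ) :
    (c • hE.kernelPair hF w).2.1 z = c * (E (conj w) * deBrangesKernel F w z) :=
  rfl

end IsHermiteBiehler

end Multiplexing

theorem corollaryC
    (E F : ℂ → ℂ) (hE : IsHermiteBiehler E) (hF : IsHermiteBiehler F)
    (φ : ℝ → ℝ) (hφ : IsPhaseFunction (E * F) φ)
    (α : ℝ) (hα : α ∈ Set.Ico 0 Real.pi)
    (I : Set ℤ) (lam : I → ℝ)
    (hlam : ∀ n : I, φ (lam n) = ((n : ℤ) : ℝ) * Real.pi + α)
    (hcomplete : IsCompleteIn (E * F) (fun n : I => deBrangesKernel (E * F) (lam n)))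
    (f g : ℂ → ℂ) (hf : f ∈ deBrangesSpace E) (hg : g ∈ deBrangesSpace F) :
    -- reconstruction of `f`, pointwise and in the norm of `H(E)`
    ((∀ z : ℂ, HasSum (fun n : I => multiplexedSample E F f g (lam n) *
        (conj (F (lam n)) * deBrangesKernel E (lam n) z /
          deBrangesKernel (E * F) (lam n) (lam n))) (f z)) ∧
      Tendsto (fun s : Finset I => deBrangesNormSq E (fun z => f z -
        ∑ n ∈ s, multiplexedSample E F f g (lam n) *
          (conj (F (lam n)) * deBrangesKernel E (lam n) z /
            deBrangesKernel (E * F) (lam n) (lam n)))) atTop (𝓝 0)) ∧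
    -- reconstruction of `g`, pointwise and in the norm of `H(F)`
    ((∀ z : ℂ, HasSum (fun n : I => multiplexedSample E F f g (lam n) *
        (E (lam n) * deBrangesKernel F (lam n) z /
          deBrangesKernel (E * F) (lam n) (lam n))) (g z)) ∧
      Tendsto (fun s : Finset I => deBrangesNormSq F (fun z => g z -
        ∑ n ∈ s, multiplexedSample E F f g (lam n) *
          (E (lam n) * deBrangesKernel F (lam n) z /
            deBrangesKernel (E * F) (lam n) (lam n)))) atTop (𝓝 0)) := by
  have horth := hφ.pairwise_deBrangesKernel_eq_zero Subtype.val_injective hlam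
  obtain ⟨hsum_f, hsum_g⟩ :=
    hE.hasSum_kernelPair hF horth hcomplete (⟨f, hf⟩, ⟨g, hg⟩) fun n => rfl
  have hf_sum := hE.hasSum_apply hsum_f
  have hf_lim := hE.tendsto_deBrangesNormSq_sub_sum hsum_f
  have hg_sum := hF.hasSum_apply hsum_g
  have hg_lim := hF.tendsto_deBrangesNormSq_sub_sum hsum_g
  simp only [hE.smul_kernelPair_fst_apply hF, hE.smul_kernelPair_snd_apply hF,
    Complex.conj_ofReal, div_mul_eq_mul_div, mul_div_assoc] at hf_sum hf_lim hg_sum hg_lim ⊢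
  exact ⟨⟨hf_sum, hf_lim⟩, ⟨hg_sum, hg_lim⟩⟩
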